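/- Let $R$ be a commutative Artinian ring and let $\Lambda$ be an Artin $R$-algebra (an $R$-algebra that is finitely generated as an $R$-module) with Jacobson radical $r$. Assume that $\Lambda$ is basic (the left module $\Lambda$ is a direct sum of pairwise non-isomorphic indecomposable modules), connected (nonzero and without central idempotents other than $0$ and $1$) and not semisimple. "Module" means finitely generated left $\Lambda$-module. For a module $M$ let $$P_1(M)\to P_0(M)\to M\to 0$$ be the start of a minimal projective resolution of $M$, i.e. $P_0(M)\to M$ is a projective cover and $P_1(M)\to P_0(M)$ is a projective cover of the kernel of $P_0(M)\to M$. Let $\operatorname{Tr}M$ be the cokernel of $\operatorname{Hom}_\Lambda(P_0(M),\Lambda)\to\operatorname{Hom}_\Lambda(P_1(M),\Lambda)$, let $\mathbb D=\operatorname{Hom}_R(-,E)$ with $E$ the injective envelope of $R/\operatorname{rad}R$, and let $\tau M=\mathbb D\operatorname{Tr}M$ be the Auslander–Reiten translate. The module $M$ is called $\tau$-rigid if $\operatorname{Hom}_\Lambda(M,\tau M)=0$. **Theorem 3.12.** Suppose that $r^2=0$, that $\Lambda$ is of finite representation type (there are only finitely many isomorphism classes of indecomposable modules), and that $\Lambda$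 is Gorenstein ($\Lambda$ has the same finite injective dimension as a left and as a right module over itself). 1. If $\Lambda$ is self-injective and local, then every indecomposable $\tau$-rigid module is projective. 2. If $\Lambda$ is self-injective but not local, then every indecomposable module is $\tau$-rigid. 3. If $\Lambda$ has finite global dimension, then an indecomposable module $M$ is $\tau$-rigid if and only if $P_0(M)$ and $P_1(M)$ have no non-zero direct summand in common (up to isomorphism). -/

import Mathlib

universe u w

noncomputable section

namespace TauRigid

/-! ### Projective covers -/

/-- `π : P → M` is a projective cover: `P` is projective and finitely generated, `π` is onto and
its kernel is superfluous (small) in `P`. -/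
structure IsProjectiveCover {Λ : Type u} [Ring Λ] {P M : Type*} [AddCommGroup P] [Module Λ P]
    [AddCommGroup M] [Module Λ M] (π : P →ₗ[Λ] M) : Prop where
  projective : Module.Projective Λ P
  finite : Module.Finite Λ P
  surjective : Function.Surjective π
  superfluous : ∀ N : Submodule Λ P, N ⊔ LinearMap.ker π = ⊤ → N = ⊤

/-- Finitely generated modules over an Artinian ring have projective covers. -/
theorem exists_projectiveCover (Λ : Type u) [Ring Λ] [IsArtinianRing Λ] (M : Type*)
    [AddCommGroup M] [Module Λ M] [Module.Finite Λ M] :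
    ∃ (P : ModuleCat.{u} Λ) (π : P →ₗ[Λ] M), IsProjectiveCover π := by
  obtain ⟨n, p, hp⟩ := Module.Finite.exists_fin' Λ M
  let F := Fin n → Λ
  let S : Set (Submodule Λ F) :=
    {N | (∃ C, IsCompl N C) ∧ Function.Surjective (p ∘ₗ N.subtype)}
  have hS : S.Nonempty := by
    refine ⟨⊤, ⟨⊥, isCompl_top_bot⟩, fun m => ?_⟩
    obtain ⟨x, rfl⟩ := hp m
    exact ⟨⟨x, trivial⟩, rfl⟩
  obtain ⟨N, ⟨⟨C, hC⟩, hN⟩, hmin⟩ := WellFounded.has_min (wellFounded_lt (α := Submodule Λ F)) S hS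
  have hproj : Module.Projective Λ N :=
    Module.Projective.of_split N.subtype (N.projectionOnto C hC)
      (LinearMap.ext fun x => by simp)
  refine ⟨ModuleCat.of Λ N, p ∘ₗ N.subtype, hproj, ?_, hN, ?_⟩
  · exact Module.Finite.of_fg (IsNoetherian.noetherian N)
  intro N' hN'
  change Submodule Λ N at N'
  have hsurj : Function.Surjective ((p ∘ₗ N.subtype) ∘ₗ N'.subtype) := by
    intro m
    obtain ⟨x, rfl⟩ := hN m
    have hx : x ∈ N' ⊔ LinearMap.ker (p ∘ₗ N.subtype) := by
      have : x ∈ (⊤ : Submodule Λ N) := trivial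
      exact hN' ▸ this
    obtain ⟨y, hy, z, hz, rfl⟩ := Submodule.mem_sup.1 hx
    refine ⟨⟨y, hy⟩, ?_⟩
    rw [map_add, LinearMap.mem_ker.1 hz, add_zero]
    rfl
  obtain ⟨g, hg⟩ := Module.projective_lifting_property _ (p ∘ₗ N.subtype) hsurj
  let f : Module.End Λ N := N'.subtype ∘ₗ g
  have hf : ∀ x, (p ∘ₗ N.subtype) (f x) = (p ∘ₗ N.subtype) x := fun x => LinearMap.congr_fun hg x
  have hfn : ∀ k x, (p ∘ₗ N.subtype) ((f ^ k) x) = (p ∘ₗ N.subtype) x := by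
    intro k
    induction k with
    | zero => intro x; rfl
    | succ k ih => intro x; rw [pow_succ, Module.End.mul_apply, ih, hf]
  obtain ⟨k, hk⟩ :=
    ((LinearMap.eventually_isCompl_ker_pow_range_pow f).and (Filter.eventually_ge_atTop 1)).exists
  let B : Submodule Λ F := (LinearMap.range (f ^ k)).map N.subtype
  have hBN : B ≤ N := Submodule.map_subtype_le _ _
  have hBS : B ∈ S := by
    refine ⟨⟨(LinearMap.ker (f ^ k)).map N.subtype ⊔ C, ?_⟩, ?_⟩
    · have hsup : B ⊔ (LinearMap.ker (f ^ k)).map N.subtype = N := by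
        rw [← Submodule.map_sup, sup_comm, hk.1.sup_eq_top, Submodule.map_top,
          Submodule.range_subtype]
      have hdis : Disjoint B ((LinearMap.ker (f ^ k)).map N.subtype) := by
        rw [disjoint_iff, ← Submodule.map_inf _ N.injective_subtype, inf_comm, hk.1.inf_eq_bot,
          Submodule.map_bot]
      refine ⟨?_, ?_⟩
      · refine hdis.disjoint_sup_right_of_disjoint_sup_left ?_
        rw [hsup]
        exact hC.disjoint
      · rw [codisjoint_iff, ← sup_assoc, hsup]
        exact hC.sup_eq_top
    · intro m
      obtain ⟨x, rfl⟩ := hN m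
      exact ⟨⟨_, Submodule.mem_map_of_mem (LinearMap.mem_range_self (f ^ k) x)⟩, hfn k x⟩
  have hBeq : B = N := by
    by_contra hne
    exact hmin B hBS (lt_of_le_of_ne hBN hne)
  rw [eq_top_iff]
  intro x _
  have hx : (x : F) ∈ B := by rw [hBeq]; exact x.2
  obtain ⟨y, ⟨z, rfl⟩, hy⟩ := hx
  have hxy : (f ^ k) z = x := Subtype.ext hy
  obtain ⟨l, hl⟩ : ∃ l, k = l + 1 := ⟨k - 1, by omega⟩
  rw [← hxy, hl, pow_succ', Module.End.mul_apply]
  exact (g _).2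

/-! ### Injective envelopes -/

/-- `ι : X → E` is an injective envelope: `E` is injective and `ι` is an essential
monomorphism. -/
structure IsInjectiveEnvelope {R : Type w} [Ring R] {X E : Type w} [AddCommGroup X] [Module R X]
    [AddCommGroup E] [Module R E] (ι : X →ₗ[R] E) : Prop where
  injective : Module.Injective R E
  mono : Function.Injective ι
  essential : ∀ N : Submodule R E, N ⊓ LinearMap.range ι = ⊥ → N = ⊥

/-- Every module has an injective envelope. -/
theorem exists_injectiveEnvelope (R : Type w) [Ring R] (X : Type w) [AddCommGroup X]
    [Module R X] :
    ∃ (E : ModuleCat.{w} R) (ι : X →ₗ[R] E), IsInjectiveEnvelope ι := by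
  obtain ⟨pres⟩ := CategoryTheory.EnoughInjectives.presentation (ModuleCat.of R X)
  let J : ModuleCat.{w} R := pres.J
  let j : X →ₗ[R] J := pres.f.hom
  have hj : Function.Injective j := (ModuleCat.mono_iff_injective pres.f).1 pres.mono
  have hJ : Module.Injective R J :=
    haveI : CategoryTheory.Injective (ModuleCat.of R J) := pres.injective
    Module.injective_module_of_injective_object R J
  have hB : Module.Baer R J := Module.Baer.of_injective hJ
  let S : Submodule R J := LinearMap.range j
  let T : Set (Submodule R J) := {E | S ≤ E ∧ ∀ N ≤ E, N ⊓ S = ⊥ → N = ⊥}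
  have hST : S ∈ T := ⟨le_rfl, fun N hN h => by rwa [inf_eq_left.2 hN] at h⟩
  obtain ⟨E, hSE, hE⟩ := zorn_le_nonempty₀ T (by
    intro c hc hchain y hy
    refine ⟨sSup c, ⟨(hc hy).1.trans (le_sSup hy), ?_⟩, fun z hz => le_sSup hz⟩
    intro N hN hNS
    rw [eq_bot_iff]
    intro x hx
    obtain ⟨E, hEc, hxE⟩ :=
      (Submodule.mem_sSup_of_directed ⟨y, hy⟩ hchain.directedOn).1 (hN hx)
    have h0 := (hc hEc).2 (Submodule.span R {x})
      ((Submodule.span_singleton_le_iff_mem _ _).2 hxE)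
      (eq_bot_iff.2 (hNS ▸ inf_le_inf_right S
        ((Submodule.span_singleton_le_iff_mem _ _).2 hx)))
    rw [Submodule.span_singleton_eq_bot] at h0
    simp [h0]) S hST
  obtain ⟨C, -, hC⟩ := zorn_le_nonempty₀ {C : Submodule R J | C ⊓ E = ⊥} (by
    intro c hc hchain y hy
    refine ⟨sSup c, ?_, fun z hz => le_sSup hz⟩
    change sSup c ⊓ E = ⊥
    rw [eq_bot_iff]
    rintro x ⟨hx, hxE⟩
    obtain ⟨D, hDc, hxD⟩ := (Submodule.mem_sSup_of_directed ⟨y, hy⟩ hchain.directedOn).1 hx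
    have : x ∈ D ⊓ E := ⟨hxD, hxE⟩
    rwa [hc hDc] at this) ⊥ (by simp)
  have hCE : C ⊓ E = ⊥ := hC.prop
  let g : E →ₗ[R] J ⧸ C := C.mkQ ∘ₗ E.subtype
  have hg : Function.Injective g := by
    rw [← LinearMap.ker_eq_bot, eq_bot_iff]
    intro x hx
    have h1 : (x : J) ∈ C := by simpa [g] using hx
    have h2 : (x : J) ∈ C ⊓ E := ⟨h1, x.2⟩
    rw [hCE] at h2
    simpa using h2
  obtain ⟨h, hh⟩ := hB.extension_property g hg E.subtype
  let q : J →ₗ[R] J := h ∘ₗ C.mkQ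
  have hqE : ∀ x ∈ E, q x = x := fun x hx => LinearMap.congr_fun hh ⟨x, hx⟩
  have hqC : ∀ x ∈ C, q x = 0 := fun x hx => by
    have : C.mkQ x = 0 := by simpa using hx
    simp only [q, LinearMap.comp_apply, this, map_zero]
  have hFT : LinearMap.range q ∈ T := by
    refine ⟨fun x hx => ⟨x, hqE x (hE.prop.1 hx)⟩, fun N hN hNS => ?_⟩
    have hNE : N ⊓ E = ⊥ := hE.prop.2 _ inf_le_right (by
      rw [inf_assoc, inf_eq_right.2 hE.prop.1, hNS])
    have hle : C ≤ N.comap q := fun x hx => by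
      rw [Submodule.mem_comap, hqC x hx]
      exact N.zero_mem
    have hmem : N.comap q ⊓ E = ⊥ := by
      rw [eq_bot_iff]
      rintro x ⟨hx, hxE⟩
      have : x ∈ N ⊓ E := ⟨by simpa [hqE x hxE] using hx, hxE⟩
      rwa [hNE] at this
    have heq : N.comap q ≤ C := hC.le_of_ge hmem hle
    rw [eq_bot_iff]
    intro y hy
    obtain ⟨x, rfl⟩ := hN hy
    simpa using hqC x (heq hy)
  have hFE : LinearMap.range q ≤ E :=
    hE.le_of_ge hFT fun x hx => ⟨x, hqE x hx⟩
  let r : J →ₗ[R] E := q.codRestrict E fun x => hFE ⟨x, rfl⟩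
  refine ⟨ModuleCat.of R E, j.codRestrict E fun x => hSE ⟨x, rfl⟩, ⟨?_⟩, ?_, ?_⟩
  · intro A B _ _ _ _ f hf a
    obtain ⟨b, hb⟩ := hB.extension_property f hf (E.subtype ∘ₗ a)
    refine ⟨r ∘ₗ b, fun x => Subtype.ext ?_⟩
    have h1 : b (f x) = (a x : J) := LinearMap.congr_fun hb x
    change q (b (f x)) = _
    rw [h1]
    exact hqE _ (a x).2
  · intro x y hxy
    exact hj (congrArg Subtype.val hxy)
  · intro N hN
    change Submodule R E at N
    have h0 : N.map E.subtype ⊓ S = ⊥ := by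
      rw [eq_bot_iff]
      rintro _ ⟨⟨x, hx, rfl⟩, ⟨y, hy⟩⟩
      have h1 : x ∈ N ⊓ LinearMap.range (j.codRestrict E fun x => hSE ⟨x, rfl⟩) :=
        ⟨hx, ⟨y, Subtype.ext hy⟩⟩
      rw [hN] at h1
      have h2 : x = 0 := h1
      simp [h2]
    have h1 := hE.prop.2 _ (Submodule.map_subtype_le _ _) h0
    exact Submodule.map_injective_of_injective E.injective_subtype
      (h1.trans (Submodule.map_bot _).symm)

/-! ### The start of the minimal projective resolution and the Auslander-Reiten translate

Throughout, `R` is a commutative Artinian ring and `Λ` an `R`-algebra that is finitely generated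
as an `R`-module, that is, an Artin algebra over `R`. Modules are left modules; right modules are
modules over `Λᵐᵒᵖ`. -/

section Translate

variable (R : Type w) [CommRing R] [IsArtinianRing R] (Λ : Type u) [Ring Λ] [Algebra R Λ]
  [Module.Finite R Λ] (M : Type u) [AddCommGroup M] [Module Λ M] [Module.Finite Λ M]

theorem exists_projectiveCover_artin (R : Type w) [CommRing R] [IsArtinianRing R] (Λ : Type u)
    [Ring Λ] [Algebra R Λ] [Module.Finite R Λ] (M : Type u) [AddCommGroup M] [Module Λ M]
    [Module.Finite Λ M] :
    ∃ (P : ModuleCat.{u} Λ) (π : P →ₗ[Λ] M), IsProjectiveCover π :=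
  haveI : IsArtinianRing Λ := IsArtinianRing.of_finite R Λ
  exists_projectiveCover Λ M

/-- The projective cover `P₀(M)` of `M`. -/
def P₀ : ModuleCat.{u} Λ := (exists_projectiveCover_artin R Λ M).choose

/-- The covering map `P₀(M) → M`. -/
def cover : P₀ R Λ M →ₗ[Λ] M := (exists_projectiveCover_artin R Λ M).choose_spec.choose

theorem isProjectiveCover_cover : IsProjectiveCover (cover R Λ M) :=
  (exists_projectiveCover_artin R Λ M).choose_spec.choose_spec

/-- The first syzygy `Ω¹ M`, the kernel of `P₀(M) → M`. -/
abbrev Syzygy : Submodule Λ (P₀ R Λ M) := LinearMap.ker (cover R Λ M)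

instance syzygy_finite : Module.Finite Λ (Syzygy R Λ M) :=
  haveI : IsArtinianRing Λ := IsArtinianRing.of_finite R Λ
  haveI : Module.Finite Λ (P₀ R Λ M) := (isProjectiveCover_cover R Λ M).finite
  Module.Finite.of_fg (IsNoetherian.noetherian _)

/-- The second term `P₁(M)` of the minimal projective resolution, the projective cover
of `Ω¹ M`. -/
def P₁ : ModuleCat.{u} Λ := P₀ R Λ (Syzygy R Λ M)

/-- The differential `P₁(M) → P₀(M)`. -/
def differential : P₁ R Λ M →ₗ[Λ] P₀ R Λ M :=
  (Syzygy R Λ M).subtype ∘ₗ cover R Λ (Syzygy R Λ M)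

/-- The transpose `Tr M`, a right module: the cokernel of
`Hom(P₀(M), Λ) → Hom(P₁(M), Λ)`. -/
abbrev Transpose : Type u :=
  (P₁ R Λ M →ₗ[Λ] Λ) ⧸ LinearMap.range (LinearMap.lcomp Λᵐᵒᵖ Λ (differential R Λ M))

end Translate

section Dual

theorem exists_dualizing (R : Type w) [CommRing R] :
    ∃ (E : ModuleCat.{w} R) (ι : (R ⧸ Ring.jacobson R) →ₗ[R] E), IsInjectiveEnvelope ι :=
  exists_injectiveEnvelope R (R ⧸ Ring.jacobson R)

/-- The injective envelope of `R` modulo its Jacobson radical. -/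
def Dualizing (R : Type w) [CommRing R] : ModuleCat.{w} R := (exists_dualizing R).choose

/-- The inclusion of `R` modulo its Jacobson radical in its injective envelope. -/
def dualizingMap (R : Type w) [CommRing R] : (R ⧸ Ring.jacobson R) →ₗ[R] Dualizing R :=
  (exists_dualizing R).choose_spec.choose

theorem isInjectiveEnvelope_dualizingMap (R : Type w) [CommRing R] :
    IsInjectiveEnvelope (dualizingMap R) :=
  (exists_dualizing R).choose_spec.choose_spec

variable (R : Type w) [CommRing R] (N : Type u) [AddCommGroup N] [Module R N]

/-- The ordinary dual `D N = Hom_R(N, E)` of a right module `N`, where `E` is the injective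
envelope of `R` modulo its radical. -/
def Dual : Type (max u w) := N →ₗ[R] Dualizing R

instance : AddCommGroup (Dual R N) := inferInstanceAs (AddCommGroup (N →ₗ[R] Dualizing R))

instance : FunLike (Dual R N) N (Dualizing R) :=
  inferInstanceAs (FunLike (N →ₗ[R] Dualizing R) N (Dualizing R))

/-- The left `Λ`-module structure on `D N`, given by `(a • f) n = f (n a)`. -/
instance (Λ : Type u) [Ring Λ] [Algebra R Λ] [Module Λᵐᵒᵖ N] [IsScalarTower R Λᵐᵒᵖ N] :
    Module Λ (Dual R N) where
  smul a f := LinearMap.comp (M₃ := Dualizing R) f (Algebra.lsmul R R N (MulOpposite.op a))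
  one_smul f := DFunLike.ext _ _ fun n => congrArg f (one_smul Λᵐᵒᵖ n)
  mul_smul a b f := DFunLike.ext _ _ fun n =>
    congrArg f (mul_smul (MulOpposite.op b) (MulOpposite.op a) n)
  smul_zero _ := rfl
  smul_add _ _ _ := rfl
  add_smul a b f := DFunLike.ext _ _ fun n =>
    (congrArg f (add_smul (MulOpposite.op a) (MulOpposite.op b) n)).trans
      ((show N →ₗ[R] Dualizing R from f).map_add _ _)
  zero_smul f := DFunLike.ext _ _ fun n =>
    (congrArg f (zero_smul Λᵐᵒᵖ n)).trans (show N →ₗ[R] Dualizing R from f).map_zero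

theorem Dual.smul_apply (Λ : Type u) [Ring Λ] [Algebra R Λ] [Module Λᵐᵒᵖ N]
    [IsScalarTower R Λᵐᵒᵖ N] (a : Λ) (f : Dual R N) (n : N) :
    (a • f) n = f (MulOpposite.op a • n) := rfl

end Dual

section Rigid

variable (R : Type w) [CommRing R] [IsArtinianRing R] (Λ : Type u) [Ring Λ] [Algebra R Λ]
  [Module.Finite R Λ] (M : Type u) [AddCommGroup M] [Module Λ M] [Module.Finite Λ M]

/-- The Auslander-Reiten translate `τ M = D Tr M`. -/
abbrev Tau : Type (max u w) := Dual R (Transpose R Λ M)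

/-- `M` is `τ`-rigid if `Hom(M, τ M) = 0`. -/
def IsTauRigid : Prop := ∀ f : M →ₗ[Λ] Tau R Λ M, f = 0

end Rigid

/-! ### Properties of modules and algebras -/

section Properties

/-- `M` is nonzero and not a direct sum of two nonzero submodules. -/
def IsIndecomposable (Λ : Type u) [Ring Λ] (M : Type u) [AddCommGroup M] [Module Λ M] : Prop :=
  Nontrivial M ∧ ∀ A B : Submodule Λ M, IsCompl A B → A = ⊥ ∨ B = ⊥

/-- `P` and `Q` have no nonzero direct summand in common, up to isomorphism. -/
def NoCommonSummand (Λ : Type u) [Ring Λ] (P Q : Type u) [AddCommGroup P] [Module Λ P]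
    [AddCommGroup Q] [Module Λ Q] : Prop :=
  ∀ (A : Submodule Λ P) (B : Submodule Λ Q), (∃ A', IsCompl A A') → (∃ B', IsCompl B B') →
    Nonempty (A ≃ₗ[Λ] B) → A = ⊥

variable (Λ : Type u) [Ring Λ]

/-- `Λ` is basic: the regular left module is a finite direct sum of pairwise non-isomorphic
indecomposable modules. -/
def IsBasic : Prop :=
  ∃ (n : ℕ) (P : Fin n → Submodule Λ Λ), DirectSum.IsInternal P ∧
    (∀ i, IsIndecomposable Λ (P i)) ∧ ∀ i j, Nonempty (P i ≃ₗ[Λ] P j) → i = j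

/-- `Λ` is connected: it is nonzero and not a product of two nonzero rings, i.e. its only central
idempotents are `0` and `1`. -/
def IsConnected : Prop :=
  Nontrivial Λ ∧ ∀ e ∈ Subring.center Λ, IsIdempotentElem e → e = 0 ∨ e = 1

/-- The square of the Jacobson radical is zero. -/
def IsRadicalSquareZero : Prop :=
  ∀ a ∈ Ring.jacobson Λ, ∀ b ∈ Ring.jacobson Λ, a * b = 0

/-- `Λ` is Gorenstein: the left and the right regular module have the same finite injective
dimension. -/
def IsGorenstein : Prop :=
  ∃ n : ℕ, CategoryTheory.injectiveDimension (ModuleCat.of Λ Λ) = n ∧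
    CategoryTheory.injectiveDimension (ModuleCat.of Λᵐᵒᵖ Λ) = n

/-- `Λ` is of finite representation type: up to isomorphism there are only finitely many
finitely generated indecomposable modules. -/
def IsFiniteType : Prop :=
  ∃ (n : ℕ) (X : Fin n → ModuleCat.{u} Λ), ∀ M : ModuleCat.{u} Λ, Module.Finite Λ M →
    IsIndecomposable Λ M → ∃ i, Nonempty (M ≃ₗ[Λ] X i)

/-- `Λ` has finite global dimension: the projective dimensions of the finitely generated modules
are bounded. -/
def HasFiniteGlobalDimension : Prop :=
  ∃ n : ℕ, ∀ M : ModuleCat.{u} Λ, Module.Finite Λ M →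
    CategoryTheory.HasProjectiveDimensionLE M n

end Properties

end TauRigid

end

-- The pairing between `Tr M` and `M` identifies Hom(M, D Tr M) with the dual of the cokernel of
-- Hom(P₀(M), M) → Hom(P₁(M), M). Since `Dualizing R` is a cogenerator, `M` is τ-rigid exactly when
-- every map P₁(M) → M factors through the differential (`isTauRigid_of_factors`,
-- `IsTauRigid.factors`). The differential has image in rad P₀(M), so a map that factors must land
-- in rad M.
--
-- Local case: if P₁(M) ≠ 0, a functional on it takes a unit value. Composing it with Λ → M, 1 ↦ m,
-- for m outside rad M, gives a map that cannot factor. Hence P₁(M) = 0 and M is projective.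
--
-- Self-injective case: indecomposable projectives are injective, hence uniform. If JM ≠ 0, then M
-- is itself projective. Otherwise M is simple, and a nonzero map P₁(M) → M forces the syzygy to be
-- simple and isomorphic to M. Then P₀(M) has no nonzero maps to or from the other indecomposable
-- projectives, so by connectedness it is all of Λ, and Λ is local.
--
-- Third case: a common summand of P₀(M) and P₁(M) produces a map P₁(M) → M that is not radical.
-- Conversely, without a common summand all maps P₁(M) → M are radical, and these must be shown to
-- factor. Let H be the triangular matrix ring `Sep Λ` and let X = M/JM × JM be the separated
-- module. Because J² = 0, the obstruction to factoring a radical map is a derivation representing a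
-- self-extension of X that splits over the diagonal (`factors_of_extZero`). It remains to see that
-- finite type excludes such self-extensions (`IsFiniteType.extZero`).
--
-- These extensions behave as over a hereditary algebra, because derivations live on the corner eH(1
-- - e) only. If an indecomposable X had self-extensions, a minimal indecomposable submodule with
-- self-extensions would be a brick B (`exists_brick`). Iterated non-split extensions of B by itself
-- give indecomposable H-modules of every length (n + 1)·ℓ(B). Each of them is the separated module
-- of an indecomposable Λ-module (`exists_separated_equiv`), so there would be infinitely many of
-- the latter.

universe v

noncomputable section

namespace TauRigid

/-! ### Direct summands, Fitting's lemma and dual bases -/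

section General

variable {Λ : Type u} [Ring Λ]

/-- Fitting's lemma for indecomposable modules of finite length. -/
theorem IsIndecomposable.isNilpotent_or_bijective {M : Type u} [AddCommGroup M] [Module Λ M]
    [IsNoetherian Λ M] [IsArtinian Λ M] (hM : IsIndecomposable Λ M) (f : Module.End Λ M) :
    IsNilpotent f ∨ Function.Bijective f := by
  obtain ⟨k, hk, hk1⟩ :=
    ((LinearMap.eventually_isCompl_ker_pow_range_pow f).and (Filter.eventually_ge_atTop 1)).exists
  rcases hM.2 _ _ hk with h | h
  · right
    have hinj : Function.Injective f := by
      intro x y hxy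
      have h1 : Function.Injective (f ^ k) := LinearMap.ker_eq_bot.1 h
      refine h1 ?_
      obtain ⟨l, rfl⟩ : ∃ l, k = l + 1 := ⟨k - 1, by omega⟩
      simp only [pow_succ, Module.End.mul_apply, hxy]
    exact ⟨hinj, IsArtinian.surjective_of_injective_endomorphism f hinj⟩
  · left
    exact ⟨k, LinearMap.range_eq_bot.1 h⟩

theorem isCompl_range_ker_of_retraction {M N : Type*} [AddCommGroup M] [Module Λ M]
    [AddCommGroup N] [Module Λ N] {i : N →ₗ[Λ] M} {r : M →ₗ[Λ] N} (h : r ∘ₗ i = LinearMap.id) :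
    IsCompl (LinearMap.range i) (LinearMap.ker r) := by
  have h' : ∀ x, r (i x) = x := fun x => LinearMap.congr_fun h x
  refine ⟨?_, ?_⟩
  · rw [disjoint_iff, eq_bot_iff]
    rintro _ ⟨⟨x, rfl⟩, hx⟩
    have hx : r (i x) = 0 := hx
    rw [h'] at hx
    simp [hx]
  · rw [codisjoint_iff, eq_top_iff]
    intro x _
    refine Submodule.mem_sup.2 ⟨i (r x), ⟨_, rfl⟩, x - i (r x), ?_, by abel⟩
    rw [LinearMap.mem_ker, map_sub, h', sub_self]

/-- A split monomorphism from a nonzero module to an indecomposable one is bijective. -/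
theorem IsIndecomposable.bijective_of_retraction {M N : Type u} [AddCommGroup M] [Module Λ M]
    [AddCommGroup N] [Module Λ N] (hM : IsIndecomposable Λ M) [Nontrivial N]
    (i : N →ₗ[Λ] M) (r : M →ₗ[Λ] N) (h : r ∘ₗ i = LinearMap.id) : Function.Bijective i := by
  have hinj : Function.Injective i := Function.LeftInverse.injective (LinearMap.congr_fun h)
  refine ⟨hinj, ?_⟩
  have hc := isCompl_range_ker_of_retraction h
  rcases hM.2 _ _ hc with h0 | h0
  · obtain ⟨x, hx⟩ := exists_ne (0 : N)
    have : i x ∈ LinearMap.range i := ⟨x, rfl⟩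
    rw [h0] at this
    exact absurd (hinj (((Submodule.mem_bot Λ).1 this).trans (map_zero i).symm)) hx
  · rw [← LinearMap.range_eq_top]
    have := hc.sup_eq_top
    rwa [h0, sup_bot_eq] at this

/-- A linear map vanishing on the kernel of a surjective one factors through it. -/
theorem exists_factor {M N P : Type*} [AddCommGroup M] [Module Λ M] [AddCommGroup N] [Module Λ N]
    [AddCommGroup P] [Module Λ P] {c : M →ₗ[Λ] N} (hc : Function.Surjective c) (f : M →ₗ[Λ] P)
    (h : ∀ x, c x = 0 → f x = 0) : ∃ g : N →ₗ[Λ] P, ∀ x, g (c x) = f x := by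
  refine ⟨(LinearMap.ker c).liftQ f h ∘ₗ (c.quotKerEquivOfSurjective hc).symm.toLinearMap,
    fun x => ?_⟩
  have : (c.quotKerEquivOfSurjective hc).symm (c x) = Submodule.Quotient.mk x := by
    rw [LinearEquiv.symm_apply_eq]
    rfl
  rw [LinearMap.comp_apply, LinearEquiv.coe_coe, this]
  exact Submodule.liftQ_apply _ f x

theorem IsIndecomposable.of_equiv {M N : Type u} [AddCommGroup M] [Module Λ M]
    [AddCommGroup N] [Module Λ N] (hM : IsIndecomposable Λ M) (e : M ≃ₗ[Λ] N) :
    IsIndecomposable Λ N := by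
  refine ⟨haveI := hM.1; e.symm.toEquiv.nontrivial, fun A B hAB => ?_⟩
  have := (Submodule.orderIsoMapComap e).symm.isCompl hAB
  rcases hM.2 _ _ this with h | h
  · left
    exact (map_eq_bot_iff (Submodule.orderIsoMapComap e).symm).1 h
  · right
    exact (map_eq_bot_iff (Submodule.orderIsoMapComap e).symm).1 h

theorem isIndecomposable_of_isIdempotentElem {M : Type u} [AddCommGroup M] [Module Λ M]
    [Nontrivial M] (h : ∀ f : Module.End Λ M, f * f = f → f = 0 ∨ f = 1) :
    IsIndecomposable Λ M := by
  refine ⟨inferInstance, fun A B hAB => ?_⟩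
  let p : Module.End Λ M := A.subtype ∘ₗ A.projectionOnto B hAB
  have hpA : ∀ x ∈ A, p x = x := fun x hx => by
    exact congrArg Subtype.val (Submodule.projectionOnto_apply_left hAB ⟨x, hx⟩)
  have hpB : ∀ x ∈ B, p x = 0 := fun x hx => by
    simpa [p] using hx
  have hp : p * p = p := LinearMap.ext fun x => hpA _ (A.projectionOnto B hAB x).2
  rcases h p hp with h0 | h0
  · left
    rw [eq_bot_iff]
    intro x hx
    rw [← hpA x hx, h0]
    rfl
  · right
    rw [eq_bot_iff]
    intro x hx
    have := hpB x hx
    rwa [h0] at this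

theorem IsIndecomposable.eq_zero_or_eq_one {M : Type u} [AddCommGroup M] [Module Λ M]
    (hM : IsIndecomposable Λ M) (f : Module.End Λ M) (hf : f * f = f) : f = 0 ∨ f = 1 := by
  rcases hM.2 _ _ (LinearMap.IsIdempotentElem.isCompl (f := f) hf) with h | h
  · left
    exact LinearMap.range_eq_bot.1 h
  · right
    have hinj : Function.Injective f := LinearMap.ker_eq_bot.1 h
    exact LinearMap.ext fun x => hinj (LinearMap.congr_fun hf x)

/-- The dual basis lemma for finitely generated projective modules. -/
theorem exists_dualBasis (P : Type v) [AddCommGroup P] [Module Λ P] [Module.Finite Λ P]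
    [Module.Projective Λ P] :
    ∃ (n : ℕ) (p : Fin n → P) (q : Fin n → (P →ₗ[Λ] Λ)), ∀ y, ∑ i, q i y • p i = y := by
  obtain ⟨n, f, hf⟩ := Module.Finite.exists_fin' Λ P
  obtain ⟨s, hs⟩ := Module.projective_lifting_property f LinearMap.id hf
  refine ⟨n, fun i => f (Pi.single i 1), fun i => LinearMap.proj i ∘ₗ s, fun y => ?_⟩
  have h1 : f (s y) = y := LinearMap.congr_fun hs y
  conv_rhs => rw [← h1, pi_eq_sum_univ' (s y), map_sum]
  refine Finset.sum_congr rfl fun i _ => ?_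
  rw [← map_smul]
  congr 1

theorem eq_bot_of_map_subtype_eq_bot {M : Type*} [AddCommGroup M] [Module Λ M]
    {N : Submodule Λ M} {A : Submodule Λ N} (h : A.map N.subtype = ⊥) : A = ⊥ :=
  Submodule.map_injective_of_injective N.injective_subtype (h.trans (Submodule.map_bot _).symm)

end General

/-! ### The radical of a module and projective covers -/

section Radical

variable {Λ : Type u} [Ring Λ]

/-- The radical `JM` of a module over an Artinian ring. -/
abbrev rad (Λ : Type u) [Ring Λ] (M : Type*) [AddCommGroup M] [Module Λ M] : Submodule Λ M :=
  Ring.jacobson Λ • (⊤ : Submodule Λ M)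

theorem isSemisimpleModule_of_jacobson_smul [IsArtinianRing Λ] {V : Type*} [AddCommGroup V]
    [Module Λ V] (h : ∀ a ∈ Ring.jacobson Λ, ∀ v : V, a • v = 0) : IsSemisimpleModule Λ V := by
  have ht : Module.IsTorsionBySet Λ V (Ring.jacobson Λ) := fun v a => h a a.2 v
  let := ht.module
  exact ht.isSemisimpleModule_iff.1 inferInstance

theorem jacobson_smul_eq_zero {V : Type*} [AddCommGroup V] [Module Λ V] [IsSemisimpleModule Λ V]
    {a : Λ} (ha : a ∈ Ring.jacobson Λ) (v : V) : a • v = 0 :=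
  Module.mem_annihilator.1 (IsSemisimpleModule.jacobson_le_annihilator Λ V ha) v

theorem smul_mem_rad {M : Type*} [AddCommGroup M] [Module Λ M] {a : Λ}
    (ha : a ∈ Ring.jacobson Λ) (m : M) : a • m ∈ rad Λ M :=
  Submodule.smul_mem_smul ha trivial

theorem rad_le_of_smul_mem {M : Type*} [AddCommGroup M] [Module Λ M] {N : Submodule Λ M}
    (h : ∀ a ∈ Ring.jacobson Λ, ∀ m : M, a • m ∈ N) : rad Λ M ≤ N :=
  Submodule.smul_le.2 fun a ha m _ => h a ha m

theorem map_mem_rad {M N : Type*} [AddCommGroup M] [Module Λ M] [AddCommGroup N] [Module Λ N]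
    (f : M →ₗ[Λ] N) {x : M} (hx : x ∈ rad Λ M) : f x ∈ rad Λ N := by
  have : (rad Λ M).map f ≤ rad Λ N := by
    rw [Submodule.map_smul'']
    exact smul_mono_right _ le_top
  exact this ⟨x, hx, rfl⟩

theorem smul_eq_zero_of_mem_rad (h : IsRadicalSquareZero Λ) {M : Type*} [AddCommGroup M]
    [Module Λ M] {a : Λ} (ha : a ∈ Ring.jacobson Λ) {x : M} (hx : x ∈ rad Λ M) : a • x = 0 := by
  refine Submodule.smul_induction_on hx (fun b hb m _ => ?_) fun y z hy hz => ?_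
  · rw [smul_smul, h a ha b hb, zero_smul]
  · rw [smul_add, hy, hz, add_zero]

instance isSemisimpleModule_quotient_rad [IsArtinianRing Λ] (M : Type*) [AddCommGroup M]
    [Module Λ M] :
    IsSemisimpleModule Λ (M ⧸ rad Λ M) := by
  refine isSemisimpleModule_of_jacobson_smul fun a ha v => ?_
  obtain ⟨m, rfl⟩ := Submodule.mkQ_surjective _ v
  rw [← map_smul, Submodule.mkQ_apply, Submodule.Quotient.mk_eq_zero]
  exact smul_mem_rad ha m

/-- A superfluous submodule lies in every maximal submodule, hence in the module radical. The latter
is contained in JP because P/JP is semisimple. -/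
theorem le_rad_of_superfluous [IsArtinianRing Λ] {P : Type*} [AddCommGroup P] [Module Λ P]
    {K : Submodule Λ P}
    (h : ∀ N : Submodule Λ P, N ⊔ K = ⊤ → N = ⊤) : K ≤ rad Λ P := by
  have h1 : K ≤ Module.jacobson Λ P := by
    refine le_sInf fun N hN => ?_
    by_contra hK
    exact hN.1 (h N (hN.2 _ (left_lt_sup.2 hK)))
  exact h1.trans (Module.jacobson_le_of_eq_bot (IsSemisimpleModule.jacobson_eq_bot _ _))

theorem IsProjectiveCover.ker_le_rad [IsArtinianRing Λ] {P M : Type*} [AddCommGroup P] [Module Λ P]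
    [AddCommGroup M] [Module Λ M] {π : P →ₗ[Λ] M} (h : IsProjectiveCover π) :
    LinearMap.ker π ≤ rad Λ P :=
  le_rad_of_superfluous h.superfluous

/-- Nakayama's lemma. -/
theorem subsingleton_of_rad_eq_top {M : Type*} [AddCommGroup M] [Module Λ M] [Module.Finite Λ M]
    (h : rad Λ M = ⊤) : Subsingleton M := by
  have := Submodule.FG.eq_bot_of_le_jacobson_smul (R := Λ) (N := (⊤ : Submodule Λ M))
    Module.Finite.fg_top h.ge
  exact (Submodule.subsingleton_iff Λ).1 (subsingleton_of_bot_eq_top this.symm)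

/-- A projective cover of `M` splits off any projective module mapping onto `M`. -/
theorem IsProjectiveCover.exists_splitting {P Q M : Type*} [AddCommGroup P] [Module Λ P]
    [AddCommGroup Q] [Module Λ Q] [AddCommGroup M] [Module Λ M] {π : P →ₗ[Λ] M}
    (h : IsProjectiveCover π) [Module.Projective Λ Q] (f : Q →ₗ[Λ] M)
    (hf : Function.Surjective f) :
    ∃ (g : Q →ₗ[Λ] P) (s : P →ₗ[Λ] Q), π ∘ₗ g = f ∧ g ∘ₗ s = LinearMap.id := by
  obtain ⟨g, hg⟩ := Module.projective_lifting_property π f h.surjective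
  have hg' : ∀ x, π (g x) = f x := LinearMap.congr_fun hg
  have hsurj : Function.Surjective g := by
    rw [← LinearMap.range_eq_top]
    refine h.superfluous _ ?_
    rw [eq_top_iff]
    intro x _
    obtain ⟨y, hy⟩ := hf (π x)
    refine Submodule.mem_sup.2 ⟨g y, ⟨y, rfl⟩, x - g y, ?_, by abel⟩
    rw [LinearMap.mem_ker, map_sub, hg', hy, sub_self]
  have := h.projective
  obtain ⟨s, hs⟩ := Module.projective_lifting_property g LinearMap.id hsurj
  exact ⟨g, s, hg, hs⟩

end Radical

/-! ### The dualizing module is a cogenerator -/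

section Cogenerator

variable (R : Type w) [CommRing R] [IsArtinianRing R]

/-- The injective envelope of `R` modulo its radical is a cogenerator. -/
theorem exists_dualizing_apply_ne_zero {C : Type v} [AddCommGroup C] [Module R C] {c : C}
    (hc : c ≠ 0) : ∃ f : C →ₗ[R] Dualizing R, f c ≠ 0 := by
  let t : R →ₗ[R] C := LinearMap.toSpanSingleton R C c
  have hI : LinearMap.ker t ≠ ⊤ := by
    intro h
    have : (1 : R) ∈ LinearMap.ker t := h ▸ trivial
    exact hc (by simpa [t] using this)
  -- With m maximal over the annihilator of c, the composite Rc → R/m → R/rad R → E does not kill c;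
  -- the middle arrow is a splitting by semisimplicity, and injectivity of E extends the composite
  -- to C.
  obtain ⟨m, hm, hIm⟩ := Ideal.exists_le_maximal _ hI
  have hjm : Ring.jacobson R ≤ m := by
    rw [Ring.jacobson_eq_sInf_isMaximal]
    exact sInf_le hm
  have : IsSemisimpleModule R (R ⧸ Ring.jacobson R) :=
    isSemisimpleModule_of_jacobson_smul fun a ha v => by
      obtain ⟨r, rfl⟩ := Submodule.mkQ_surjective _ v
      rw [← map_smul, Submodule.mkQ_apply, Submodule.Quotient.mk_eq_zero, smul_eq_mul]
      exact Ideal.mul_mem_right _ _ ha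
  let p : (R ⧸ Ring.jacobson R) →ₗ[R] R ⧸ m := Submodule.factor hjm
  obtain ⟨s, hs⟩ := IsSemisimpleModule.lifting_property p (Submodule.factor_surjective hjm)
    LinearMap.id
  have hE := isInjectiveEnvelope_dualizingMap R
  have hsinj : Function.Injective s := fun x y h => by
    rw [← LinearMap.id_apply (R := R) x, ← hs, LinearMap.comp_apply, h, ← LinearMap.comp_apply,
      hs, LinearMap.id_apply]
  let i : (R ⧸ LinearMap.ker t) →ₗ[R] C := (LinearMap.ker t).liftQ t le_rfl
  have hi : Function.Injective i := LinearMap.ker_eq_bot.1 (Submodule.ker_liftQ_eq_bot' _ _ rfl)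
  have := hE.injective
  obtain ⟨f, hf⟩ := (Module.Baer.of_injective hE.injective).extension_property i hi
    (dualizingMap R ∘ₗ s ∘ₗ Submodule.factor hIm)
  refine ⟨f, fun h0 => ?_⟩
  have h1 := LinearMap.congr_fun hf (Submodule.Quotient.mk 1)
  have h2 : i (Submodule.Quotient.mk 1) = c := by
    change t 1 = c
    simp [t]
  rw [LinearMap.comp_apply, h2, h0] at h1
  have h3 : (Submodule.factor hIm (Submodule.Quotient.mk 1)) = 0 :=
    hsinj (hE.mono (by rw [map_zero, map_zero]; exact h1.symm))
  change Submodule.Quotient.mk 1 = (0 : R ⧸ m) at h3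
  rw [Submodule.Quotient.mk_eq_zero] at h3
  exact hm.ne_top ((Ideal.eq_top_iff_one m).2 h3)

end Cogenerator

section DualApply

variable {R : Type w} [CommRing R]

theorem Dual.apply_zero {N : Type u} [AddCommGroup N] [Module R N] (f : Dual R N) : f 0 = 0 :=
  (show N →ₗ[R] Dualizing R from f).map_zero

theorem Dual.apply_sum {N : Type u} [AddCommGroup N] [Module R N] (f : Dual R N) {ι : Type*}
    (s : Finset ι) (x : ι → N) : f (∑ i ∈ s, x i) = ∑ i ∈ s, f (x i) :=
  map_sum (show N →ₗ[R] Dualizing R from f) x s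

theorem Dual.sum_apply {N : Type u} [AddCommGroup N] [Module R N] {ι : Type*}
    (s : Finset ι) (f : ι → Dual R N) (x : N) : (∑ i ∈ s, f i) x = ∑ i ∈ s, f i x :=
  LinearMap.sum_apply (M₂ := Dualizing R) s f x

end DualApply

/-! ### τ-rigidity as a factorization property of maps P₁(M) → M -/

section Criterion

variable (R : Type w) [CommRing R] [IsArtinianRing R] (Λ : Type u) [Ring Λ] [Algebra R Λ]
  [Module.Finite R Λ] (M : Type u) [AddCommGroup M] [Module Λ M] [Module.Finite Λ M]

instance finite_P₀ : Module.Finite Λ (P₀ R Λ M) := (isProjectiveCover_cover R Λ M).finite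
instance projective_P₀ : Module.Projective Λ (P₀ R Λ M) :=
  (isProjectiveCover_cover R Λ M).projective
instance finite_P₁ : Module.Finite Λ (P₁ R Λ M) := finite_P₀ R Λ (Syzygy R Λ M)
instance projective_P₁ : Module.Projective Λ (P₁ R Λ M) := projective_P₀ R Λ (Syzygy R Λ M)

variable {R Λ M}

/-- If every map `P₁(M) → M` factors through `P₁(M) → P₀(M)` then `M` is `τ`-rigid. -/
theorem isTauRigid_of_factors
    (h : ∀ f : P₁ R Λ M →ₗ[Λ] M, ∃ g : P₀ R Λ M →ₗ[Λ] M, g ∘ₗ differential R Λ M = f) :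
    IsTauRigid R Λ M := by
  intro φ
  obtain ⟨n, p, q, hq⟩ := exists_dualBasis (Λ := Λ) (P₁ R Λ M)
  obtain ⟨n', p', q', hq'⟩ := exists_dualBasis (Λ := Λ) (P₀ R Λ M)
  -- The right-hand side depends only on the map y ↦ k y • m: the dual basis turns φ into a
  -- functional on Hom(P₁(M), M).
  have key : ∀ (k : P₁ R Λ M →ₗ[Λ] Λ) (m : M),
      ∑ i, (φ (k (p i) • m)) (Submodule.Quotient.mk (q i)) = φ m (Submodule.Quotient.mk k) := by
    intro k m
    have h1 : ∑ i, MulOpposite.op (k (p i)) • q i = k := by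
      ext y
      conv_rhs => rw [← hq y, map_sum]
      simp [LinearMap.sum_apply]
    conv_rhs => rw [← h1]
    rw [← Submodule.mkQ_apply, map_sum, Dual.apply_sum]
    refine Finset.sum_congr rfl fun i _ => ?_
    rw [map_smul, Dual.smul_apply]
    rfl
  refine LinearMap.ext fun m => DFunLike.ext _ _ fun x => ?_
  obtain ⟨k, rfl⟩ := Submodule.Quotient.mk_surjective _ x
  obtain ⟨g, hg⟩ := h (LinearMap.toSpanSingleton Λ M m ∘ₗ k)
  -- Expanding the factorization over a dual basis of P₀(M) writes y ↦ k y • m through the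
  -- functionals q' j ∘ differential, which are zero in the transpose.
  have hg' : ∀ y, k y • m = ∑ j, q' j (differential R Λ M y) • g (p' j) := fun y => by
    have := LinearMap.congr_fun hg y
    simp only [LinearMap.comp_apply, LinearMap.toSpanSingleton_apply] at this
    rw [← this]
    conv_lhs => rw [← hq' (differential R Λ M y)]
    simp
  rw [← key k m]
  simp only [hg', map_sum, Dual.sum_apply]
  rw [Finset.sum_comm]
  refine (Finset.sum_eq_zero fun j _ => ?_).trans rfl
  refine (key (q' j ∘ₗ differential R Λ M) (g (p' j))).trans ?_
  have : (Submodule.Quotient.mk (q' j ∘ₗ differential R Λ M) : Transpose R Λ M) = 0 :=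
    (Submodule.Quotient.mk_eq_zero _).2 ⟨q' j, rfl⟩
  rw [this, Dual.apply_zero]

/-- If `M` is `τ`-rigid then every map `P₁(M) → M` factors through `P₁(M) → P₀(M)`. -/
theorem IsTauRigid.factors (h : IsTauRigid R Λ M) (f : P₁ R Λ M →ₗ[Λ] M) :
    ∃ g : P₀ R Λ M →ₗ[Λ] M, g ∘ₗ differential R Λ M = f := by
  by_contra hf
  let : Module R M := Module.compHom M (algebraMap R Λ)
  have : IsScalarTower R Λ M := IsScalarTower.of_algebraMap_smul fun r m => rfl
  have : SMulCommClass Λ R M := IsScalarTower.to_smulCommClass'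
  -- The class of f in the cokernel of Hom(P₀(M), M) → Hom(P₁(M), M) is nonzero, so a functional u
  -- detects it. The pairing (m, k) ↦ u(k(·)m) is then a map M → τM; it vanishes by rigidity, yet f
  -- is a sum of maps k(·)m.
  let B := LinearMap.range (LinearMap.lcomp R M (differential R Λ M))
  have hfB : (Submodule.Quotient.mk f : (P₁ R Λ M →ₗ[Λ] M) ⧸ B) ≠ 0 := by
    rw [Ne, Submodule.Quotient.mk_eq_zero]
    rintro ⟨g, hg⟩
    exact hf ⟨g, hg⟩
  obtain ⟨u, hu⟩ := exists_dualizing_apply_ne_zero R hfB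
  let t (m : M) : (P₁ R Λ M →ₗ[Λ] Λ) →ₗ[R] Dualizing R :=
    { toFun := fun k => u (Submodule.Quotient.mk (LinearMap.toSpanSingleton Λ M m ∘ₗ k))
      map_add' := fun k k' => by
        rw [LinearMap.comp_add, Submodule.Quotient.mk_add, map_add]
      map_smul' := fun r k => by
        rw [RingHom.id_apply, ← map_smul, ← Submodule.Quotient.mk_smul]
        congr 2
        ext y
        simp }
  have ht : ∀ m k, t m (k ∘ₗ differential R Λ M) = 0 := fun m k => by
    have : (Submodule.Quotient.mk (LinearMap.toSpanSingleton Λ M m ∘ₗ k ∘ₗ differential R Λ M) :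
        (P₁ R Λ M →ₗ[Λ] M) ⧸ B) = 0 :=
      (Submodule.Quotient.mk_eq_zero _).2 ⟨LinearMap.toSpanSingleton Λ M m ∘ₗ k, rfl⟩
    change u _ = 0
    rw [this, map_zero]
  let N := LinearMap.range (LinearMap.lcomp Λᵐᵒᵖ Λ (differential R Λ M))
  let T (m : M) : Tau R Λ M :=
    ((N.restrictScalars R).liftQ (t m) (by
      rintro _ ⟨k, rfl⟩
      exact ht m k)) ∘ₗ (Submodule.Quotient.restrictScalarsEquiv R N).symm.toLinearMap
  have hT : ∀ m k, (T m) (Submodule.Quotient.mk k) = t m k := fun m k => rfl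
  let φ : M →ₗ[Λ] Tau R Λ M :=
    { toFun := T
      map_add' := fun m m' => DFunLike.ext _ _ fun x => by
        obtain ⟨k, rfl⟩ := Submodule.Quotient.mk_surjective _ x
        change t (m + m') k = t m k + t m' k
        change u _ = u _ + u _
        rw [← map_add, ← Submodule.Quotient.mk_add]
        congr 2
        ext y
        simp
      map_smul' := fun a m => DFunLike.ext _ _ fun x => by
        obtain ⟨k, rfl⟩ := Submodule.Quotient.mk_surjective _ x
        change u _ = u _
        congr 2
        ext y
        simp [mul_smul] }
  have hφ := h φ
  obtain ⟨n, p, q, hq⟩ := exists_dualBasis (Λ := Λ) (P₁ R Λ M)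
  refine hu ?_
  have h1 : f = ∑ i, LinearMap.toSpanSingleton Λ M (f (p i)) ∘ₗ q i := by
    ext y
    conv_lhs => rw [← hq y]
    simp [LinearMap.sum_apply]
  rw [h1, ← Submodule.mkQ_apply, map_sum, map_sum]
  refine Finset.sum_eq_zero fun i _ => ?_
  change (φ (f (p i))) (Submodule.Quotient.mk (q i)) = 0
  rw [hφ]
  rfl

theorem range_differential_le : LinearMap.range (differential R Λ M) ≤ rad Λ (P₀ R Λ M) := by
  have : IsArtinianRing Λ := IsArtinianRing.of_finite R Λ
  rintro _ ⟨y, rfl⟩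
  exact (isProjectiveCover_cover R Λ M).ker_le_rad (cover R Λ (Syzygy R Λ M) y).2

theorem projective_of_subsingleton_P₁ [Subsingleton (P₁ R Λ M)] : Module.Projective Λ M := by
  have h := isProjectiveCover_cover R Λ M
  have hinj : Function.Injective (cover R Λ M) := by
    rw [← LinearMap.ker_eq_bot, eq_bot_iff]
    intro x hx
    obtain ⟨y, hy⟩ := (isProjectiveCover_cover R Λ (Syzygy R Λ M)).surjective ⟨x, hx⟩
    have : y = 0 := Subsingleton.elim (α := P₁ R Λ M) y 0
    rw [this, map_zero] at hy
    exact (congrArg Subtype.val hy).symm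
  have := h.projective
  exact Module.Projective.of_equiv (LinearEquiv.ofBijective _ ⟨hinj, h.surjective⟩)

end Criterion

/-! ### Local algebras -/

section Local

variable {Λ : Type u} [Ring Λ]

/-- If a avoids a maximal left ideal I, then 1 = x + ba with x in I. As x is no unit, locality makes
ba a unit, and one-sided inverses in an Artinian ring are two-sided. -/
theorem isUnit_of_notMem_jacobson [IsArtinianRing Λ] [IsLocalRing Λ] {a : Λ}
    (ha : a ∉ Ring.jacobson Λ) : IsUnit a := by
  rw [Ring.jacobson_eq_sInf_isMaximal, Submodule.mem_sInf] at ha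
  push Not at ha
  obtain ⟨I, hI, haI⟩ := ha
  have hI : Ideal.IsMaximal I := hI
  have h1 : (1 : Λ) ∈ I ⊔ Ideal.span {a} := by
    rw [hI.1.2 (I ⊔ Ideal.span {a}) (left_lt_sup.2 fun h =>
      haI (h (Ideal.subset_span (Set.mem_singleton a))))]
    trivial
  obtain ⟨x, hx, y, hy, hxy⟩ := Submodule.mem_sup.1 h1
  obtain ⟨b, rfl⟩ := Ideal.mem_span_singleton'.1 hy
  rcases IsLocalRing.isUnit_or_isUnit_of_add_one hxy with h | h
  · exact absurd (Ideal.eq_top_of_isUnit_mem I hx h) hI.ne_top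
  · obtain ⟨c, hc⟩ := h.exists_left_inv
    rw [← mul_assoc] at hc
    have := IsDedekindFiniteMonoid.mul_eq_one_symm hc
    exact IsUnit.of_mul_eq_one _ this

/-- Over a local Artin algebra all `τ`-rigid modules are projective. -/
theorem projective_of_isTauRigid_of_isLocalRing {R : Type w} [CommRing R] [IsArtinianRing R]
    [Algebra R Λ] [Module.Finite R Λ] [IsLocalRing Λ] {M : Type u} [AddCommGroup M]
    [Module Λ M] [Module.Finite Λ M] [Nontrivial M] (h : IsTauRigid R Λ M) :
    Module.Projective Λ M := by
  have : IsArtinianRing Λ := IsArtinianRing.of_finite R Λ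
  rcases subsingleton_or_nontrivial (P₁ R Λ M) with hs | hn
  · exact projective_of_subsingleton_P₁ (R := R)
  exfalso
  obtain ⟨n, p, q, hq⟩ := exists_dualBasis (Λ := Λ) (P₁ R Λ M)
  -- If all functionals took values in J, the dual basis would give P₁(M) = J P₁(M), contrary to
  -- Nakayama.
  obtain ⟨k, y, hk⟩ : ∃ (k : P₁ R Λ M →ₗ[Λ] Λ) (y : P₁ R Λ M), k y ∉ Ring.jacobson Λ := by
    by_contra! hc
    refine not_subsingleton (P₁ R Λ M) (subsingleton_of_rad_eq_top (Λ := Λ) ?_)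
    rw [eq_top_iff]
    intro y _
    rw [← hq y]
    exact Submodule.sum_mem _ fun i _ => smul_mem_rad (hc _ _) _
  obtain ⟨m, hm⟩ : ∃ m : M, m ∉ rad Λ M := by
    by_contra! hc
    exact not_subsingleton M (subsingleton_of_rad_eq_top (Λ := Λ) (eq_top_iff.2 fun m _ => hc m))
  obtain ⟨g, hg⟩ := h.factors (LinearMap.toSpanSingleton Λ M m ∘ₗ k)
  have h1 : k y • m ∈ rad Λ M := by
    have := LinearMap.congr_fun hg y
    simp only [LinearMap.comp_apply, LinearMap.toSpanSingleton_apply] at this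
    rw [← this]
    exact map_mem_rad g (range_differential_le ⟨y, rfl⟩)
  obtain ⟨b, hb⟩ := (isUnit_of_notMem_jacobson hk).exists_left_inv
  refine hm ?_
  rw [← one_smul Λ m, ← hb, mul_smul]
  exact Submodule.smul_mem _ _ h1

end Local

/-! ### Common summands of P₀(M) and P₁(M) -/

section Rigid

variable {R : Type w} [CommRing R] [IsArtinianRing R] {Λ : Type u} [Ring Λ] [Algebra R Λ]
  [Module.Finite R Λ] {M : Type u} [AddCommGroup M] [Module Λ M] [Module.Finite Λ M]

/-- A common summand A gives F : P₁(M) → A → P₀(M). Rigidity factors cover ∘ F through the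
differential; lifting the factor to P₀(M) shows that F agrees with a radical map modulo ker(cover) ≤
rad P₀(M). So F is radical, whence A = JA and A = 0. -/
theorem noCommonSummand_of_isTauRigid (h : IsTauRigid R Λ M) :
    NoCommonSummand Λ (P₀ R Λ M) (P₁ R Λ M) := by
  rintro A B ⟨A', hA⟩ ⟨B', hB⟩ ⟨e⟩
  have hart : IsArtinianRing Λ := IsArtinianRing.of_finite R Λ
  let F : P₁ R Λ M →ₗ[Λ] P₀ R Λ M := A.subtype ∘ₗ e.symm.toLinearMap ∘ₗ B.projectionOnto B' hB
  obtain ⟨g, hg⟩ := h.factors (cover R Λ M ∘ₗ F)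
  have hc := isProjectiveCover_cover R Λ M
  obtain ⟨g', hg'⟩ := Module.projective_lifting_property (cover R Λ M) g hc.surjective
  have hF : ∀ y, F y ∈ rad Λ (P₀ R Λ M) := by
    intro y
    have h1 : F y - g' (differential R Λ M y) ∈ rad Λ (P₀ R Λ M) := by
      refine hc.ker_le_rad ?_
      rw [LinearMap.mem_ker, map_sub, sub_eq_zero]
      exact (LinearMap.congr_fun hg y).symm.trans (LinearMap.congr_fun hg' _).symm
    have h2 : g' (differential R Λ M y) ∈ rad Λ (P₀ R Λ M) :=
      map_mem_rad g' (range_differential_le ⟨y, rfl⟩)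
    simpa using add_mem h1 h2
  have hAr : rad Λ A = ⊤ := by
    rw [eq_top_iff]
    intro a _
    have h1 := map_mem_rad (A.projectionOnto A' hA) (hF (e a))
    have h2 : F (e a) = a := by
      change (e.symm (B.projectionOnto B' hB (e a)) : P₀ R Λ M) = a
      rw [Submodule.projectionOnto_apply_left, e.symm_apply_apply]
    rw [h2, Submodule.projectionOnto_apply_left] at h1
    exact h1
  have : Module.Finite Λ A := Module.Finite.of_fg (IsNoetherian.noetherian A)
  have := subsingleton_of_rad_eq_top hAr
  exact (Submodule.subsingleton_iff_eq_bot).1 this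

/-- If `P₀(M)` and `P₁(M)` have no common summand, all maps `P₁(M) → M` are radical. -/
theorem range_le_rad_of_noCommonSummand (h : NoCommonSummand Λ (P₀ R Λ M) (P₁ R Λ M))
    (f : P₁ R Λ M →ₗ[Λ] M) (y : P₁ R Λ M) : f y ∈ rad Λ M := by
  have hart : IsArtinianRing Λ := IsArtinianRing.of_finite R Λ
  by_contra hy
  let t : P₁ R Λ M →ₗ[Λ] M ⧸ rad Λ M := (rad Λ M).mkQ ∘ₗ f
  have ht : t y ≠ 0 := by
    intro h0
    exact hy ((Submodule.Quotient.mk_eq_zero _).1 h0)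
  have hne : LinearMap.range t ≠ ⊥ := fun h0 => by
    have : t y ∈ LinearMap.range t := ⟨y, rfl⟩
    rw [h0] at this
    exact ht this
  -- Both P₀(M) and P₁(M) map onto a simple submodule S of the image in M/JM, so the projective
  -- cover of S is a summand of each.
  obtain ⟨S, hSt, hS⟩ := (IsSemisimpleModule.eq_bot_or_exists_simple_le
    (LinearMap.range t)).resolve_left hne
  have : IsSimpleModule Λ S := hS
  obtain ⟨C, hC⟩ := exists_isCompl S
  have h1 : Function.Surjective (S.projectionOnto C hC ∘ₗ t) := fun s => by
    obtain ⟨x, hx⟩ := hSt s.2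
    exact ⟨x, by rw [LinearMap.comp_apply, hx, Submodule.projectionOnto_apply_left]⟩
  have h0 : Function.Surjective (S.projectionOnto C hC ∘ₗ (rad Λ M).mkQ ∘ₗ cover R Λ M) :=
    fun s => by
      obtain ⟨x, hx⟩ := ((rad Λ M).mkQ_surjective.comp
        (isProjectiveCover_cover R Λ M).surjective) s
      refine ⟨x, ?_⟩
      rw [LinearMap.comp_apply, LinearMap.comp_apply]
      exact (congrArg _ hx).trans (Submodule.projectionOnto_apply_left hC s)
  have hSf : Module.Finite Λ S := inferInstance
  obtain ⟨Q, π, hπ⟩ := exists_projectiveCover Λ S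
  obtain ⟨g₀, s₀, -, hs₀⟩ := hπ.exists_splitting _ h0
  obtain ⟨g₁, s₁, -, hs₁⟩ := hπ.exists_splitting _ h1
  have hi₀ : Function.Injective s₀ := Function.LeftInverse.injective (LinearMap.congr_fun hs₀)
  have hi₁ : Function.Injective s₁ := Function.LeftInverse.injective (LinearMap.congr_fun hs₁)
  have hb := h (LinearMap.range s₀) (LinearMap.range s₁)
    ⟨_, isCompl_range_ker_of_retraction hs₀⟩ ⟨_, isCompl_range_ker_of_retraction hs₁⟩
    ⟨(LinearEquiv.ofInjective s₀ hi₀).symm ≪≫ₗ LinearEquiv.ofInjective s₁ hi₁⟩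
  have := IsSimpleModule.nontrivial Λ S
  obtain ⟨s, hs⟩ := exists_ne (0 : S)
  obtain ⟨x, rfl⟩ := hπ.surjective s
  have : s₀ x ∈ LinearMap.range s₀ := ⟨x, rfl⟩
  rw [hb, Submodule.mem_bot] at this
  rw [hi₀ (this.trans (map_zero s₀).symm), map_zero] at hs
  exact hs rfl

end Rigid

/-! ### Injective modules and decompositions of the regular module -/

section Injective

variable {Λ : Type u} [Ring Λ]

theorem Injective.of_retract {P Q : Type u} [AddCommGroup P] [Module Λ P] [AddCommGroup Q]
    [Module Λ Q] (h : Module.Injective Λ Q) (i : P →ₗ[Λ] Q) (r : Q →ₗ[Λ] P)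
    (hr : ∀ x, r (i x) = x) : Module.Injective Λ P := by
  refine ⟨fun X Y _ _ _ _ f hf g => ?_⟩
  obtain ⟨k, hk⟩ := h.out f hf (i ∘ₗ g)
  exact ⟨r ∘ₗ k, fun x => by rw [LinearMap.comp_apply, hk, LinearMap.comp_apply, hr]⟩

/-- Over a self-injective ring finitely generated projective modules are injective. -/
theorem injective_of_projective (h : Module.Injective Λ Λ) (P : Type u) [AddCommGroup P]
    [Module Λ P] [Module.Finite Λ P] [Module.Projective Λ P] : Module.Injective Λ P := by
  obtain ⟨n, f, hf⟩ := Module.Finite.exists_fin' Λ P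
  obtain ⟨s, hs⟩ := Module.projective_lifting_property f LinearMap.id hf
  have : Module.Injective Λ (Fin n → Λ) := Module.Injective.pi Λ _
  exact Injective.of_retract this s f (LinearMap.congr_fun hs)

/-- Indecomposable injective modules of finite length are uniform. -/
theorem IsIndecomposable.inf_ne_bot {Q : Type u} [AddCommGroup Q] [Module Λ Q]
    [IsNoetherian Λ Q] [IsArtinian Λ Q] (hQ : IsIndecomposable Λ Q) (hi : Module.Injective Λ Q)
    {A B : Submodule Λ Q} (hA : A ≠ ⊥) (hB : B ≠ ⊥) : A ⊓ B ≠ ⊥ := by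
  intro hAB
  let i : (A × B) →ₗ[Λ] Q := A.subtype.coprod B.subtype
  have hinj : Function.Injective i := by
    rw [← LinearMap.ker_eq_bot, eq_bot_iff]
    rintro ⟨a, b⟩ hab
    have hab : (a : Q) + b = 0 := by simpa [i] using hab
    have ha : (a : Q) ∈ A ⊓ B := ⟨a.2, by
      rw [eq_neg_of_add_eq_zero_left hab]
      exact neg_mem b.2⟩
    rw [hAB, Submodule.mem_bot] at ha
    rw [ha, zero_add] at hab
    exact Prod.ext (Subtype.ext ha) (Subtype.ext hab)
  -- If A ∩ B = 0, the projection A ⊕ B → A extends to an endomorphism θ of Q. It fixes A, so it is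
  -- not nilpotent; it kills B, so it is not injective. Fitting's lemma forbids this.
  obtain ⟨θ, hθ⟩ := hi.out i hinj (A.subtype ∘ₗ LinearMap.fst Λ A B)
  obtain ⟨a, ha, ha0⟩ := Submodule.exists_mem_ne_zero_of_ne_bot hA
  obtain ⟨b, hb, hb0⟩ := Submodule.exists_mem_ne_zero_of_ne_bot hB
  have h1 : θ a = a := by simpa [i] using hθ (⟨a, ha⟩, 0)
  have h2 : θ b = 0 := by simpa [i] using hθ (0, ⟨b, hb⟩)
  rcases hQ.isNilpotent_or_bijective θ with ⟨k, hk⟩ | h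
  · have h3 : ∀ k : ℕ, (θ ^ k) a = a := by
      intro k
      induction k with
      | zero => rfl
      | succ k ih => rw [pow_succ, Module.End.mul_apply, h1, ih]
    exact ha0 (by rw [← h3 k, hk]; rfl)
  · exact hb0 (h.1 (h2.trans (map_zero θ).symm))

theorem isSimpleModule_of_isIndecomposable {M : Type u} [AddCommGroup M] [Module Λ M]
    [IsSemisimpleModule Λ M] (hM : IsIndecomposable Λ M) : IsSimpleModule Λ M := by
  have := hM.1
  refine { toIsSimpleOrder := ⟨fun A => ?_⟩ }
  obtain ⟨B, hB⟩ := exists_isCompl A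
  rcases hM.2 A B hB with h | h
  · exact Or.inl h
  · right
    have := hB.sup_eq_top
    rwa [h, sup_bot_eq] at this

/-- The components of a decomposition of the regular module. -/
theorem exists_components {n : ℕ} {P : Fin n → Submodule Λ Λ} (hP : DirectSum.IsInternal P) :
    ∃ c : ∀ i, Λ →ₗ[Λ] P i, (∀ x, ∑ i, (c i x : Λ) = x) ∧ (∀ i (x : P i), c i x = x) ∧
      ∀ i j (x : P j), i ≠ j → c i x = 0 := by
  classical
  let e : (DirectSum (Fin n) fun i => P i) ≃ₗ[Λ] Λ :=
    LinearEquiv.ofBijective (DirectSum.coeLinearMap P) hP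
  have he : ∀ j (x : P j), e.symm (x : Λ) = DirectSum.lof Λ (Fin n) (fun i => P i) j x := by
    intro j x
    rw [LinearEquiv.symm_apply_eq]
    exact (DirectSum.coeLinearMap_lof P j x).symm
  refine ⟨fun i => DirectSum.component Λ (Fin n) (fun i => P i) i ∘ₗ e.symm.toLinearMap,
    fun x => ?_, fun i x => ?_, fun i j x hij => ?_⟩
  · obtain ⟨y, rfl⟩ := e.surjective x
    simp only [LinearMap.comp_apply, LinearEquiv.coe_coe, LinearEquiv.symm_apply_apply]
    change ∑ i, (y i : Λ) = DirectSum.coeLinearMap P y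
    rw [DirectSum.coeLinearMap_eq_dfinsuppSum, DFinsupp.sum_eq_sum_fintype]
    · rfl
    · exact fun i => rfl
  · simp only [LinearMap.comp_apply, LinearEquiv.coe_coe, he]
    exact DirectSum.component.lof_self (M := fun i => P i) Λ i x
  · simp only [LinearMap.comp_apply, LinearEquiv.coe_coe, he]
    rw [DirectSum.component.of, dif_neg hij.symm]

end Injective

/-! ### Self-injective algebras with radical square zero -/

section SelfInjective

variable {Λ : Type u} [Ring Λ]

/-- A decomposition of the regular module with a factor that admits no nonzero maps from or to the
other ones gives a central idempotent; over a connected ring this factor is everything. -/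
theorem IsConnected.component_eq_self (hconn : IsConnected Λ) {n : ℕ} {P : Fin n → Submodule Λ Λ}
    {c : ∀ i, Λ →ₗ[Λ] P i} (hsum : ∀ x, ∑ i, (c i x : Λ) = x) (hself : ∀ i (x : P i), c i x = x)
    (i : Fin n) (hne : Nontrivial (P i)) (hfrom : ∀ j ≠ i, ∀ f : P i →ₗ[Λ] P j, f = 0)
    (hto : ∀ j ≠ i, ∀ f : P j →ₗ[Λ] P i, f = 0) (x : Λ) : (c i x : Λ) = x := by
  let ρ (a : Λ) : Λ →ₗ[Λ] Λ := LinearMap.toSpanSingleton Λ Λ a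
  have h1 : ∀ (p : P i) (a : Λ), (c i (p * a) : Λ) = p * a := by
    intro p a
    refine Eq.trans ?_ (hsum (p * a))
    refine (Finset.sum_eq_single_of_mem (f := fun j => (c j (p * a) : Λ)) i (Finset.mem_univ i)
      fun j _ hj => ?_).symm
    have := LinearMap.congr_fun (hfrom j hj (c j ∘ₗ ρ a ∘ₗ (P i).subtype)) p
    exact congrArg Subtype.val this
  have h2 : ∀ j ≠ i, ∀ (p : P j) (a : Λ), c i (p * a) = 0 := by
    intro j hj p a
    exact LinearMap.congr_fun (hto j hj (c i ∘ₗ ρ a ∘ₗ (P j).subtype)) p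
  -- Maps out of and into P i vanish off P i, and right multiplications are left-linear. So the
  -- projection to P i is also left multiplication by c i 1, besides the right multiplication of h4;
  -- this makes c i 1 central.
  have h3 : ∀ a, (c i a : Λ) = c i 1 * a := by
    intro a
    conv_lhs => rw [← one_mul a, ← hsum 1, Finset.sum_mul, map_sum]
    rw [Finset.sum_eq_single_of_mem i (Finset.mem_univ i) fun j _ hj => h2 j hj _ _, h1]
  have h4 : ∀ a, (c i a : Λ) = a * c i 1 := by
    intro a
    conv_lhs => rw [← mul_one a, ← smul_eq_mul, map_smul]
    rfl
  have h5 : IsIdempotentElem (c i 1 : Λ) := by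
    rw [IsIdempotentElem, ← h3, hself]
  rcases hconn.2 _ (Subring.mem_center_iff.2 fun a => by rw [← h3, ← h4]) h5 with h | h
  · exfalso
    obtain ⟨p, hp⟩ := exists_ne (0 : P i)
    refine hp (Subtype.ext ?_)
    rw [← hself i p, h3, h, zero_mul]
    rfl
  · rw [h3, h, one_mul]

/-- Fitting's lemma applied to right multiplication by a: either a is nilpotent, and 1 - a is a
unit, or a is a unit. -/
theorem isLocalRing_of_isIndecomposable [IsArtinianRing Λ] (h : IsIndecomposable Λ Λ) :
    IsLocalRing Λ := by
  have := h.1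
  refine IsLocalRing.of_isUnit_or_isUnit_one_sub_self fun a => ?_
  let ρ : Module.End Λ Λ := LinearMap.toSpanSingleton Λ Λ a
  rcases h.isNilpotent_or_bijective ρ with ⟨k, hk⟩ | hb
  · right
    have h1 : ∀ k : ℕ, (ρ ^ k) 1 = a ^ k := by
      intro k
      induction k with
      | zero => simp
      | succ k ih => rw [pow_succ', Module.End.mul_apply, ih, pow_succ]; rfl
    refine IsNilpotent.isUnit_one_sub ⟨k, ?_⟩
    rw [← h1, hk]
    rfl
  · left
    obtain ⟨b, hb⟩ := hb.2 1
    exact IsUnit.of_mul_eq_one _ (IsDedekindFiniteMonoid.mul_eq_one_symm hb)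

/-- JM ≠ 0 is detected by a map from some P i to M that does not vanish on its radical. Since P i is
injective and uniform and J² = 0, this map is injective. It therefore splits, and indecomposability
of M makes it bijective. -/
theorem projective_of_rad_ne_bot [IsArtinianRing Λ] (hinj : Module.Injective Λ Λ)
    (hrad : IsRadicalSquareZero Λ) {n : ℕ} {P : Fin n → Submodule Λ Λ}
    {c : ∀ i, Λ →ₗ[Λ] P i} (hsum : ∀ x, ∑ i, (c i x : Λ) = x) (hself : ∀ i (x : P i), c i x = x)
    (hind : ∀ i, IsIndecomposable Λ (P i)) {M : Type u} [AddCommGroup M] [Module Λ M]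
    (hM : IsIndecomposable Λ M) {a : Λ} (ha : a ∈ Ring.jacobson Λ) {m : M} (ham : a • m ≠ 0) :
    Module.Projective Λ M := by
  obtain ⟨i, hi⟩ : ∃ i, a • ((c i 1 : Λ) • m) ≠ 0 := by
    by_contra! h
    refine ham ?_
    conv_lhs => rw [← one_smul Λ m, ← hsum 1, Finset.sum_smul, Finset.smul_sum]
    exact Finset.sum_eq_zero fun i _ => h i
  let f : P i →ₗ[Λ] M := LinearMap.toSpanSingleton Λ M m ∘ₗ (P i).subtype
  have hPinj : Module.Injective Λ (P i) := Injective.of_retract hinj (P i).subtype (c i) (hself i)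
  have hPproj : Module.Projective Λ (P i) :=
    Module.Projective.of_split (P i).subtype (c i) (LinearMap.ext (hself i))
  have := (hind i).1
  let x : P i := a • c i 1
  have hfx : f x ≠ 0 := by
    change (a * (c i 1 : Λ)) • m ≠ 0
    rwa [mul_smul]
  -- The cyclic module on x is semisimple because J² = 0. A complement D in it of its part in ker f
  -- meets ker f trivially, so if ker f ≠ 0 uniformity gives D = 0 and f x = 0.
  have hker : LinearMap.ker f = ⊥ := by
    by_contra hk
    have hx0 : Submodule.span Λ {x} ≠ ⊥ := fun h => hfx (by
      rw [Submodule.span_singleton_eq_bot.1 h, map_zero])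
    have hss : IsSemisimpleModule Λ (Submodule.span Λ {x}) := by
      refine isSemisimpleModule_of_jacobson_smul fun b hb v => Subtype.ext ?_
      obtain ⟨r, hr⟩ := Submodule.mem_span_singleton.1 v.2
      change b • (v : P i) = 0
      rw [← hr, smul_smul]
      change (b * r) • a • c i 1 = 0
      rw [smul_smul, hrad _ (Ideal.mul_mem_right r _ hb) a ha, zero_smul]
    obtain ⟨D, hD⟩ := exists_isCompl ((LinearMap.ker f).comap (Submodule.span Λ {x}).subtype)
    have hdis : LinearMap.ker f ⊓ D.map (Submodule.span Λ {x}).subtype = ⊥ := by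
      rw [eq_bot_iff]
      rintro _ ⟨hy, ⟨y, hyD, rfl⟩⟩
      have : y ∈ (LinearMap.ker f).comap (Submodule.span Λ {x}).subtype ⊓ D := ⟨hy, hyD⟩
      rw [hD.inf_eq_bot, Submodule.mem_bot] at this
      rw [this]
      exact Submodule.zero_mem _
    have hD0 : D = ⊥ := by
      by_contra hD0
      refine (hind i).inf_ne_bot hPinj hk (fun h => hD0 ?_) hdis
      exact eq_bot_of_map_subtype_eq_bot h
    have htop := hD.sup_eq_top
    rw [hD0, sup_bot_eq] at htop
    have : (⟨x, Submodule.mem_span_singleton_self x⟩ : Submodule.span Λ {x}) ∈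
        (LinearMap.ker f).comap (Submodule.span Λ {x}).subtype := htop ▸ trivial
    exact hfx this
  have hfinj : Function.Injective f := LinearMap.ker_eq_bot.1 hker
  -- `P i` is injective, so `f` splits
  obtain ⟨r, hr⟩ := hPinj.out f hfinj LinearMap.id
  exact Module.Projective.of_equiv
    (LinearEquiv.ofBijective f (hM.bijective_of_retraction f r (LinearMap.ext hr)))

variable {R : Type w} [CommRing R] [IsArtinianRing R] [Algebra R Λ] [Module.Finite R Λ]

/-- For projective M the cover splits; by minimality the syzygy is zero, hence so is P₁(M), and the
criterion is vacuous. -/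
theorem isTauRigid_of_projective {M : Type u} [AddCommGroup M] [Module Λ M] [Module.Finite Λ M]
    [Module.Projective Λ M] : IsTauRigid R Λ M := by
  refine isTauRigid_of_factors fun f => ⟨0, ?_⟩
  have hc := isProjectiveCover_cover R Λ M
  obtain ⟨s, hs⟩ := Module.projective_lifting_property (cover R Λ M) LinearMap.id hc.surjective
  have hs' : ∀ m, cover R Λ M (s m) = m := LinearMap.congr_fun hs
  have htop := hc.superfluous _ (isCompl_range_ker_of_retraction hs).sup_eq_top
  have hker : ∀ z : Syzygy R Λ M, z = 0 := by
    rintro ⟨z, hz⟩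
    obtain ⟨m, rfl⟩ : z ∈ LinearMap.range s := htop ▸ trivial
    have : m = 0 := by rw [← hs' m]; exact hz
    exact Subtype.ext (by simp [this])
  have hc1 := isProjectiveCover_cover R Λ (Syzygy R Λ M)
  have hbot : (⊥ : Submodule Λ (P₁ R Λ M)) = ⊤ := hc1.superfluous ⊥ (by
    rw [bot_sup_eq, eq_top_iff]
    intro y _
    exact hker _)
  refine LinearMap.ext fun y => ?_
  have hy : y ∈ (⊥ : Submodule Λ (P₁ R Λ M)) := hbot ▸ trivial
  rw [(Submodule.mem_bot Λ).1 hy, map_zero, map_zero]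

/-- Over a connected basic self-injective nonlocal Artin algebra with radical square zero all
indecomposable modules are `τ`-rigid. -/
theorem isTauRigid_of_injective (hbasic : IsBasic Λ) (hconn : IsConnected Λ)
    (hrad : IsRadicalSquareZero Λ) (hinj : Module.Injective Λ Λ) (hloc : ¬ IsLocalRing Λ)
    {M : Type u} [AddCommGroup M] [Module Λ M] [Module.Finite Λ M]
    (hM : IsIndecomposable Λ M) : IsTauRigid R Λ M := by
  have hart : IsArtinianRing Λ := IsArtinianRing.of_finite R Λ
  obtain ⟨n, P, hP, hind, hiso⟩ := hbasic
  obtain ⟨c, hsum, hself, -⟩ := exists_components hP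
  by_cases hJM : ∀ a ∈ Ring.jacobson Λ, ∀ m : M, a • m = 0
  swap
  · push Not at hJM
    obtain ⟨a, ha, m, ham⟩ := hJM
    have := projective_of_rad_ne_bot hinj hrad hsum hself hind hM ha ham
    exact isTauRigid_of_projective
  have hss : IsSemisimpleModule Λ M := isSemisimpleModule_of_jacobson_smul hJM
  have hMs : IsSimpleModule Λ M := isSimpleModule_of_isIndecomposable hM
  have hMnt := hM.1
  refine isTauRigid_of_factors fun f => ⟨0, ?_⟩
  by_contra hf
  have hf : f ≠ 0 := fun h => hf (by rw [h, LinearMap.zero_comp])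
  let Q := P₀ R Λ M
  let K : Submodule Λ Q := Syzygy R Λ M
  let π : Q →ₗ[Λ] M := cover R Λ M
  have hπ : IsProjectiveCover π := isProjectiveCover_cover R Λ M
  have hQinj : Module.Injective Λ Q := injective_of_projective hinj Q
  have hQnt : Nontrivial Q := hπ.surjective.nontrivial
  -- Since M is simple, a submodule not inside the superfluous kernel K maps onto M and is
  -- everything.
  have hsub : ∀ A : Submodule Λ Q, A ≤ K ∨ A = ⊤ := by
    intro A
    rcases eq_bot_or_eq_top (A.map π) with h | h
    · left
      intro x hx
      have : π x ∈ A.map π := ⟨x, hx, rfl⟩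
      rw [h] at this
      exact this
    · right
      refine hπ.superfluous A (eq_top_iff.2 fun x _ => ?_)
      obtain ⟨y, hy, hxy⟩ : π x ∈ A.map π := h ▸ trivial
      refine Submodule.mem_sup.2 ⟨y, hy, x - y, ?_, by abel⟩
      rw [LinearMap.mem_ker, map_sub, hxy, sub_self]
  have hQind : IsIndecomposable Λ Q := by
    refine ⟨hQnt, fun A B hAB => ?_⟩
    rcases hsub A with hA | hA
    · rcases hsub B with hB | hB
      · exfalso
        have : (⊤ : Submodule Λ Q) ≤ K := hAB.sup_eq_top ▸ sup_le hA hB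
        obtain ⟨m, hm⟩ := exists_ne (0 : M)
        obtain ⟨x, rfl⟩ := hπ.surjective m
        exact hm (this trivial)
      · left
        have := hAB.inf_eq_bot
        rwa [hB, inf_top_eq] at this
    · right
      have := hAB.inf_eq_bot
      rwa [hA, top_inf_eq] at this
  have hKr : K ≤ rad Λ Q := hπ.ker_le_rad
  have hKss : IsSemisimpleModule Λ K := by
    refine isSemisimpleModule_of_jacobson_smul fun a ha v => Subtype.ext ?_
    change a • (v : Q) = 0
    exact smul_eq_zero_of_mem_rad hrad ha (hKr v.2)
  -- the given map factors through the syzygy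
  obtain ⟨u, hu⟩ : ∃ u : K →ₗ[Λ] M, ∀ x, u (cover R Λ (Syzygy R Λ M) x) = f x := by
    refine exists_factor (isProjectiveCover_cover R Λ (Syzygy R Λ M)).surjective f fun x hx => ?_
    have h1 := map_mem_rad f ((isProjectiveCover_cover R Λ (Syzygy R Λ M)).ker_le_rad hx)
    exact (Submodule.mem_bot Λ).1 (rad_le_of_smul_mem (N := ⊥) (fun a ha m => hJM a ha m) h1)
  have hu0 : u ≠ 0 := by
    rintro rfl
    exact hf (LinearMap.ext fun x => (hu x).symm)
  have hKnt : Nontrivial K := by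
    by_contra h
    rw [not_nontrivial_iff_subsingleton] at h
    exact hu0 (LinearMap.ext fun x => by rw [Subsingleton.elim x 0, map_zero, map_zero])
  have hKind : IsIndecomposable Λ K := by
    refine ⟨hKnt, fun A B hAB => ?_⟩
    by_contra! h
    refine hQind.inf_ne_bot hQinj (A := A.map K.subtype) (B := B.map K.subtype)
      (fun h0 => h.1 ?_) (fun h0 => h.2 ?_) ?_
    · exact eq_bot_of_map_subtype_eq_bot h0
    · exact eq_bot_of_map_subtype_eq_bot h0
    · rw [← Submodule.map_inf _ K.injective_subtype, hAB.inf_eq_bot, Submodule.map_bot]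
  -- K is semisimple and, as a submodule of a uniform module, indecomposable, so it is simple. The
  -- nonzero u is then an isomorphism K ≅ M, and both composition factors of Q are M.
  have hKs : IsSimpleModule Λ K := isSimpleModule_of_isIndecomposable hKind
  have hub : Function.Bijective u := LinearMap.bijective_of_ne_zero hu0
  let ue : K ≃ₗ[Λ] M := LinearEquiv.ofBijective u hub
  have hKat : IsAtom K := isSimpleModule_iff_isAtom.1 hKs
  have hPinj : ∀ i, Module.Injective Λ (P i) := fun i =>
    Injective.of_retract hinj (P i).subtype (c i) (hself i)
  have hPproj : ∀ i, Module.Projective Λ (P i) := fun i =>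
    Module.Projective.of_split (P i).subtype (c i) (LinearMap.ext (hself i))
  have hPQ : ∀ i (f : P i →ₗ[Λ] M), f ≠ 0 → Nonempty (P i ≃ₗ[Λ] Q) := by
    intro i f hf
    obtain ⟨g, s, -, hgs⟩ := hπ.exists_splitting f (LinearMap.surjective_of_ne_zero hf)
    exact ⟨(LinearEquiv.ofBijective s ((hind i).bijective_of_retraction s g hgs)).symm⟩
  obtain ⟨m, hm⟩ := exists_ne (0 : M)
  obtain ⟨i, hi⟩ : ∃ i, (c i 1 : Λ) • m ≠ 0 := by
    by_contra! h
    refine hm ?_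
    conv_lhs => rw [← one_smul Λ m, ← hsum 1, Finset.sum_smul]
    exact Finset.sum_eq_zero fun i _ => h i
  obtain ⟨e⟩ := hPQ i (LinearMap.toSpanSingleton Λ M m ∘ₗ (P i).subtype) fun h =>
    hi (LinearMap.congr_fun h (c i 1))
  have hjM : ∀ j ≠ i, ∀ f : P j →ₗ[Λ] M, f = 0 := by
    intro j hj f
    by_contra hf
    obtain ⟨e'⟩ := hPQ j f hf
    exact hj (hiso j i ⟨e' ≪≫ₗ e.symm⟩)
  have hto : ∀ j ≠ i, ∀ g : P j →ₗ[Λ] Q, g = 0 := by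
    intro j hj g
    have h1 : ∀ x, g x ∈ K := fun x => LinearMap.congr_fun (hjM j hj (π ∘ₗ g)) x
    have h2 := hjM j hj (u ∘ₗ g.codRestrict K h1)
    refine LinearMap.ext fun x => ?_
    have h3 : g.codRestrict K h1 x = 0 :=
      hub.1 ((LinearMap.congr_fun h2 x).trans (map_zero u).symm)
    exact congrArg Subtype.val h3
  -- An injective g would split and make P j isomorphic to Q. Otherwise ker g contains the simple K,
  -- and g induces an embedding M → P j. Injectivity of Q extends M ≅ K ⊂ Q along it to a nonzero
  -- map P j → Q, against hto.
  have hfrom : ∀ j ≠ i, ∀ g : Q →ₗ[Λ] P j, g = 0 := by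
    intro j hj g
    by_contra hg
    by_cases hk : LinearMap.ker g = ⊥
    · obtain ⟨r, hr⟩ := hQinj.out g (LinearMap.ker_eq_bot.1 hk) LinearMap.id
      have hb := (hind j).bijective_of_retraction g r (LinearMap.ext hr)
      exact hj (hiso j i ⟨(e ≪≫ₗ LinearEquiv.ofBijective g hb).symm⟩)
    have hKg : K ≤ LinearMap.ker g := by
      rcases hKat.le_iff.1 (inf_le_left : K ⊓ LinearMap.ker g ≤ K) with h | h
      · exact absurd h (hQind.inf_ne_bot hQinj hKat.1 hk)
      · exact inf_eq_left.1 h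
    obtain ⟨v, hv⟩ := exists_factor hπ.surjective g fun x hx => hKg hx
    have hv0 : v ≠ 0 := by
      rintro rfl
      exact hg (LinearMap.ext fun x => (hv x).symm)
    obtain ⟨h, hh⟩ := hQinj.out v (LinearMap.injective_of_ne_zero hv0)
      (K.subtype ∘ₗ ue.symm.toLinearMap)
    have h1 := hh m
    rw [hto j hj h] at h1
    have h2 : ue.symm m = 0 := Subtype.ext h1.symm
    exact hm (by simpa using h2)
  have hfull := hconn.component_eq_self hsum hself i (hind i).1
    (fun j hj f => by
      have := hfrom j hj (f ∘ₗ e.symm.toLinearMap)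
      refine LinearMap.ext fun x => ?_
      simpa using LinearMap.congr_fun this (e x))
    (fun j hj f => by
      have := hto j hj (e.toLinearMap ∘ₗ f)
      refine LinearMap.ext fun x => e.injective ?_
      simpa using LinearMap.congr_fun this x)
  refine hloc (isLocalRing_of_isIndecomposable ((hind i).of_equiv
    (LinearEquiv.ofBijective (P i).subtype ⟨(P i).injective_subtype, fun x => ?_⟩)))
  exact ⟨c i x, hfull x⟩

end SelfInjective

/-! ### Extensions that split over the diagonal, described by derivations -/

section Derivations

variable {H : Type u} [Ring H]

/-- Derivations `H → Hom_ℤ(X, Y)` that vanish on the subring `A`; they are the cocycles of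
extensions of `X` by `Y` that split over `A`. -/
structure IsDer (A : Subring H) {X Y : Type*} [AddCommGroup X] [Module H X] [AddCommGroup Y]
    [Module H Y] (δ : H →+ X →+ Y) : Prop where
  leibniz : ∀ r s x, δ (r * s) x = r • δ s x + δ r (s • x)
  vanish : ∀ a ∈ A, δ a = 0

/-- All extensions of `X` by `Y` that split over `A` are split. -/
def ExtZero (A : Subring H) (X Y : Type*) [AddCommGroup X] [Module H X] [AddCommGroup Y]
    [Module H Y] : Prop :=
  ∀ δ : H →+ X →+ Y, IsDer A δ → ∃ h : X →+ Y, ∀ r x, δ r x = r • h x - h (r • x)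

/-- `A` contains the diagonal Peirce components with respect to `e ∈ A`, and `(1 - e) H e = 0`
up to elements of `A`. -/
structure IsTriangular (A : Subring H) (e : H) : Prop where
  mem : e ∈ A
  mul_mem : ∀ r, r * e ∈ A
  one_sub_mul_mem : ∀ r, (1 - e) * r ∈ A

variable {A : Subring H} {e : H}
variable {X Y Z : Type*} [AddCommGroup X] [Module H X] [AddCommGroup Y] [Module H Y]
  [AddCommGroup Z] [Module H Z]

/-- Together with `IsDer.smul_apply`: because r * e and (1 - e) * r lie in A, each δ r kills eX and
takes values in eY. This corner concentration is what makes the extension theory hereditary. -/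
theorem IsDer.apply_smul (he : IsTriangular A e) {δ : H →+ X →+ Y} (hδ : IsDer A δ) (r : H)
    (x : X) : δ r (e • x) = 0 := by
  have h1 := hδ.leibniz r e x
  rw [hδ.vanish _ (he.mul_mem r), hδ.vanish _ he.mem] at h1
  simpa using h1.symm

theorem IsDer.smul_apply (he : IsTriangular A e) {δ : H →+ X →+ Y} (hδ : IsDer A δ) (r : H)
    (x : X) : e • δ r x = δ r x := by
  have h1 := hδ.leibniz (1 - e) r x
  rw [hδ.vanish _ (he.one_sub_mul_mem r), hδ.vanish _ (sub_mem A.one_mem he.mem)] at h1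
  simp only [AddMonoidHom.zero_apply, add_zero, sub_smul, one_smul] at h1
  exact (sub_eq_zero.1 h1.symm).symm

theorem IsDer.apply_one_sub_smul (he : IsTriangular A e) {δ : H →+ X →+ Y} (hδ : IsDer A δ)
    (r : H) (x : X) : δ r ((1 - e) • x) = δ r x := by
  rw [sub_smul, one_smul, map_sub, hδ.apply_smul he, sub_zero]

/-- An A-linear section s of q need not be H-linear, but it commutes with r on eZ since r * e ∈ A,
and δ takes values there. So s ∘ δ is again a derivation, and applying q to a trivialization of it
trivializes δ. -/
theorem ExtZero.of_surjective (he : IsTriangular A e) [IsSemisimpleModule A Y]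
    (h : ExtZero A X Y) (q : Y →ₗ[H] Z) (hq : Function.Surjective q) : ExtZero A X Z := by
  intro δ hδ
  obtain ⟨s, hs⟩ := IsSemisimpleModule.lifting_property (q.restrictScalars A) hq LinearMap.id
  have hs' : ∀ z, q (s z) = z := LinearMap.congr_fun hs
  have hsA : ∀ a ∈ A, ∀ z, s (a • z) = a • s z := fun a ha z => s.map_smul ⟨a, ha⟩ z
  obtain ⟨k, hk⟩ := h ((AddMonoidHom.compHom s.toAddMonoidHom).comp δ)
    { leibniz := fun r t x => by
        change s (δ (r * t) x) = r • s (δ t x) + s (δ r (t • x))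
        rw [hδ.leibniz, map_add, ← hδ.smul_apply he t x, smul_smul, hsA _ (he.mul_mem r), mul_smul,
          ← hsA _ he.mem, hδ.smul_apply he]
      vanish := fun a ha => by
        ext x
        change s (δ a x) = 0
        rw [hδ.vanish a ha, AddMonoidHom.zero_apply, map_zero] }
  refine ⟨q.toAddMonoidHom.comp k, fun r x => ?_⟩
  have h1 := congrArg q (hk r x)
  change q (s (δ r x)) = _ at h1
  rw [hs', map_sub, map_smul] at h1
  exact h1

/-- Dually, δ composed with an A-linear retraction s of i is a derivation: δ only sees (1 -
e)-parts, and on these s commutes with t because (1 - e) * t ∈ A. -/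
theorem ExtZero.of_injective (he : IsTriangular A e) [IsSemisimpleModule A X]
    (h : ExtZero A X Y) (i : Z →ₗ[H] X) (hi : Function.Injective i) : ExtZero A Z Y := by
  intro δ hδ
  obtain ⟨s, hs⟩ := IsSemisimpleModule.extension_property (i.restrictScalars A) hi LinearMap.id
  have hs' : ∀ z, s (i z) = z := LinearMap.congr_fun hs
  have hsA : ∀ a ∈ A, ∀ z, s (a • z) = a • s z := fun a ha z => s.map_smul ⟨a, ha⟩ z
  obtain ⟨k, hk⟩ := h ((AddMonoidHom.compHom' s.toAddMonoidHom).comp δ)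
    { leibniz := fun r t x => by
        change δ (r * t) (s x) = r • δ t (s x) + δ r (s (t • x))
        rw [hδ.leibniz, ← hδ.apply_one_sub_smul he r (t • s x),
          ← hδ.apply_one_sub_smul he r (s (t • x)), smul_smul,
          ← hsA _ (sub_mem A.one_mem he.mem), smul_smul, hsA _ (he.one_sub_mul_mem t)]
      vanish := fun a ha => by
        ext x
        change δ a (s x) = 0
        rw [hδ.vanish a ha, AddMonoidHom.zero_apply] }
  refine ⟨k.comp i.toAddMonoidHom, fun r x => ?_⟩
  have h1 := hk r (i x)
  change δ r (s (i x)) = _ at h1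
  rw [hs', ← map_smul i] at h1
  exact h1

/-- This is the piece Hom(X, Y) → Hom(K, Y) → Ext(Z, Y) of the long exact sequence. For an A-linear
section s of θ, the failure r s(z) - s(r z) of H-linearity, pushed along p, is the obstruction
derivation. A trivialization k corrects p(x - sθx) to the H-linear map p(x - sθx) + k(θx). -/
theorem ExtZero.exists_extension [IsSemisimpleModule A X] (h : ExtZero A Z Y) (θ : X →ₗ[H] Z)
    (hθ : Function.Surjective θ) {K : Submodule H X} (hK : ∀ x, x ∈ K ↔ θ x = 0)
    (p : K →ₗ[H] Y) : ∃ P : X →ₗ[H] Y, ∀ k : K, P k = p k := by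
  obtain ⟨s, hs⟩ := IsSemisimpleModule.lifting_property (θ.restrictScalars A) hθ LinearMap.id
  have hs' : ∀ z, θ (s z) = z := LinearMap.congr_fun hs
  have hsA : ∀ a ∈ A, ∀ z, s (a • z) = a • s z := fun a ha z => s.map_smul ⟨a, ha⟩ z
  let κ (r : H) (z : Z) : K := ⟨r • s z - s (r • z), by
    rw [hK, map_sub, map_smul, hs', hs', sub_self]⟩
  let δ : H →+ Z →+ Y := AddMonoidHom.mk' (fun r => AddMonoidHom.mk' (fun z => p (κ r z))
    fun z z' => by
      rw [← map_add]
      congr 1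
      apply Subtype.ext
      simp only [κ, smul_add, map_add, Submodule.coe_add]
      abel)
    fun r r' => by
      ext z
      change p (κ (r + r') z) = p (κ r z) + p (κ r' z)
      rw [← map_add]
      congr 1
      apply Subtype.ext
      simp only [κ, add_smul, map_add, Submodule.coe_add]
      abel
  have hδ : ∀ r z, δ r z = p (κ r z) := fun _ _ => rfl
  obtain ⟨k, hk⟩ := h δ
    { leibniz := fun r t z => by
        rw [hδ, hδ, hδ, ← map_smul, ← map_add]
        congr 1
        apply Subtype.ext
        simp only [κ, Submodule.coe_add, Submodule.coe_smul, smul_sub, mul_smul]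
        abel
      vanish := fun a ha => by
        ext z
        rw [hδ]
        have : κ a z = 0 := Subtype.ext (by simp only [κ, hsA a ha, sub_self, Submodule.coe_zero])
        rw [this, map_zero, AddMonoidHom.zero_apply] }
  let π (x : X) : K := ⟨x - s (θ x), by rw [hK, map_sub, hs', sub_self]⟩
  refine ⟨{ toFun := fun x => p (π x) + k (θ x), map_add' := fun x y => ?_,
            map_smul' := fun r x => ?_ }, fun x => ?_⟩
  · have : π (x + y) = π x + π y := Subtype.ext (by
      simp only [π, map_add, Submodule.coe_add]
      abel)
    rw [this, map_add, map_add, map_add]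
    abel
  · have h1 : π (r • x) = r • π x + κ r (θ x) := Subtype.ext (by
      simp only [π, κ, map_smul, Submodule.coe_add, Submodule.coe_smul, smul_sub]
      abel)
    have h2 := hk r (θ x)
    rw [hδ] at h2
    rw [RingHom.id_apply, h1, map_add, map_smul, map_smul, h2, smul_add]
    abel
  · have h1 : θ x = 0 := (hK x).1 x.2
    have h2 : π x = x := Subtype.ext (by simp [π, h1])
    change p (π x) + k (θ x) = p x
    rw [h2, h1, map_zero, add_zero]

/-- The extension of `X` by `Y` defined by a derivation. -/
@[nolint unusedArguments]
def Twist (A : Subring H) {X Y : Type u} [AddCommGroup X] [Module H X] [AddCommGroup Y]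
    [Module H Y] (δ : H →+ X →+ Y) (_ : IsDer A δ) : Type u := Y × X

namespace Twist

variable {X Y : Type u} [AddCommGroup X] [Module H X] [AddCommGroup Y] [Module H Y]
  {δ : H →+ X →+ Y} (hδ : IsDer A δ)

instance : AddCommGroup (Twist A δ hδ) := inferInstanceAs (AddCommGroup (Y × X))

instance : Module H (Twist A δ hδ) where
  smul r z := (r • z.1 + δ r z.2, r • z.2)
  one_smul z := Prod.ext (by
    change (1 : H) • z.1 + δ 1 z.2 = z.1
    rw [hδ.vanish 1 A.one_mem, one_smul, AddMonoidHom.zero_apply, add_zero]) (one_smul H z.2)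
  mul_smul r s z := Prod.ext (by
    change (r * s) • z.1 + δ (r * s) z.2 = r • (s • z.1 + δ s z.2) + δ r (s • z.2)
    rw [hδ.leibniz, mul_smul, smul_add, add_assoc]) (mul_smul r s z.2)
  smul_zero r := Prod.ext (by
    change r • (0 : Y) + δ r 0 = 0
    rw [smul_zero, map_zero, add_zero]) (smul_zero r)
  smul_add r z z' := Prod.ext (by
    change r • (z.1 + z'.1) + δ r (z.2 + z'.2) = (r • z.1 + δ r z.2) + (r • z'.1 + δ r z'.2)
    rw [smul_add, map_add]
    abel) (smul_add r z.2 z'.2)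
  add_smul r s z := Prod.ext (by
    change (r + s) • z.1 + δ (r + s) z.2 = (r • z.1 + δ r z.2) + (s • z.1 + δ s z.2)
    rw [add_smul, map_add, AddMonoidHom.add_apply]
    abel) (add_smul r s z.2)
  zero_smul z := Prod.ext (by
    change (0 : H) • z.1 + δ 0 z.2 = 0
    rw [zero_smul, map_zero, AddMonoidHom.zero_apply, add_zero]) (zero_smul H z.2)

theorem smul_fst (r : H) (z : Twist A δ hδ) : (r • z).1 = r • z.1 + δ r z.2 := rfl

/-- The inclusion of `Y`. -/
def inl : Y →ₗ[H] Twist A δ hδ where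
  toFun y := (y, 0)
  map_add' y y' := Prod.ext rfl (add_zero (0 : X)).symm
  map_smul' r y := Prod.ext (by
    change r • y = r • y + δ r 0
    rw [map_zero, add_zero]) (smul_zero r).symm

/-- The projection to `X`. -/
def snd : Twist A δ hδ →ₗ[H] X where
  toFun z := z.2
  map_add' _ _ := rfl
  map_smul' _ _ := rfl

theorem inl_injective : Function.Injective (inl hδ) := fun _ _ h => congrArg Prod.fst h

theorem snd_surjective : Function.Surjective (snd hδ) := fun x => ⟨(0, x), rfl⟩

theorem exact : Function.Exact (inl hδ) (snd hδ) := fun z =>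
  ⟨fun h => ⟨z.1, Prod.ext rfl (show z.2 = 0 from h).symm⟩, by rintro ⟨y, rfl⟩; rfl⟩

theorem isSemisimpleModule [IsSemisimpleModule A X] [IsSemisimpleModule A Y] :
    IsSemisimpleModule A (Twist A δ hδ) := by
  let i₁ : Y →ₗ[A] Twist A δ hδ := (inl hδ).restrictScalars A
  let i₂ : X →ₗ[A] Twist A δ hδ :=
    { toFun := fun x => (0, x)
      map_add' := fun x x' => Prod.ext (add_zero (0 : Y)).symm rfl
      map_smul' := fun a x => Prod.ext (by
        change (0 : Y) = (a : H) • (0 : Y) + δ a x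
        rw [hδ.vanish a a.2, smul_zero, AddMonoidHom.zero_apply, add_zero]) rfl }
  have h₁ : IsSemisimpleModule A (LinearMap.range i₁) := IsSemisimpleModule.range i₁
  have h₂ : IsSemisimpleModule A (LinearMap.range i₂) := IsSemisimpleModule.range i₂
  have h₃ := IsSemisimpleModule.sup h₁ h₂
  have htop : LinearMap.range i₁ ⊔ LinearMap.range i₂ = ⊤ := by
    rw [eq_top_iff]
    intro z _
    refine Submodule.mem_sup.2 ⟨i₁ z.1, ⟨z.1, rfl⟩, i₂ z.2, ⟨z.2, rfl⟩, ?_⟩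
    exact Prod.ext (add_zero z.1) (zero_add z.2)
  rw [htop] at h₃
  exact IsSemisimpleModule.congr Submodule.topEquiv.symm

/-- The negated first coordinate of a section would trivialize δ. -/
theorem not_section (hn : ¬ ∃ h : X →+ Y, ∀ r x, δ r x = r • h x - h (r • x))
    (s : X →ₗ[H] Twist A δ hδ) (hs : ∀ x, snd hδ (s x) = x) : False := by
  refine hn ⟨AddMonoidHom.mk' (fun x => -(s x).1) fun x y => ?_, fun r x => ?_⟩
  · rw [map_add]
    exact neg_add _ _
  · have h1 : (s (r • x)).1 = r • (s x).1 + δ r (s x).2 := by rw [map_smul, smul_fst]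
    have h2 : (s x).2 = x := hs x
    rw [h2] at h1
    change δ r x = r • -(s x).1 - -(s (r • x)).1
    rw [h1, smul_neg]
    abel

end Twist

end Derivations

/-! ### From self-extensions to long indecomposable modules -/

section Bricks

variable {H : Type u} [Ring H] {A : Subring H} {e : H}

theorem isSemisimpleModule_submodule {X : Type*} [AddCommGroup X] [Module H X]
    [IsSemisimpleModule A X] (N : Submodule H X) : IsSemisimpleModule A N :=
  IsSemisimpleModule.of_injective (N.subtype.restrictScalars A) N.injective_subtype

theorem ExtZero.congr (he : IsTriangular A e) {X Y : Type*} [AddCommGroup X] [Module H X]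
    [AddCommGroup Y] [Module H Y] [IsSemisimpleModule A X] (h : ExtZero A X X)
    (f : X ≃ₗ[H] Y) : ExtZero A Y Y :=
  (h.of_surjective he f.toLinearMap f.surjective).of_injective he f.symm.toLinearMap
    f.symm.injective

/-- A nonzero module all of whose nonzero endomorphisms are bijective. -/
def IsBrick (H : Type*) [Ring H] (B : Type*) [AddCommGroup B] [Module H B] : Prop :=
  Nontrivial B ∧ ∀ f : Module.End H B, f = 0 ∨ Function.Bijective f

/-- An endomorphism of an indecomposable module with maximal kernel among the nonzero
non-bijective ones has square zero. -/
theorem comp_self_eq_zero_of_maximal_ker {N : Type u} [AddCommGroup N] [Module H N]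
    [IsNoetherian H N] [IsArtinian H N] (hN : IsIndecomposable H N) {θ : Module.End H N}
    (hθ0 : θ ≠ 0) (hθb : ¬ Function.Bijective θ)
    (hmax : ∀ ψ : Module.End H N, ψ ≠ 0 → LinearMap.ker θ ≤ LinearMap.ker ψ →
      LinearMap.ker ψ = LinearMap.ker θ) (x : N) : θ (θ x) = 0 := by
  by_contra hx
  have hker := hmax (θ * θ) (fun h => hx (LinearMap.congr_fun h x))
    (fun y hy => by
      change θ (θ y) = 0
      rw [LinearMap.mem_ker.1 hy, map_zero])
  have hstep : ∀ y, θ (θ y) = 0 → θ y = 0 := fun y hy => by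
    have : y ∈ LinearMap.ker (θ * θ) := hy
    rwa [hker] at this
  obtain ⟨k, hk⟩ := (hN.isNilpotent_or_bijective θ).resolve_right hθb
  have : ∀ k y, (θ ^ k) (θ y) = 0 → θ y = 0 := by
    intro k
    induction k with
    | zero => exact fun y h => h
    | succ k ih =>
      intro y h
      rw [pow_succ, Module.End.mul_apply] at h
      exact hstep y (ih (θ y) h)
  exact hθ0 (LinearMap.ext fun y => this k y (by rw [hk]; rfl))

/-- A direct summand that is minimal among those receiving a nonzero component of a given map is
indecomposable. -/
theorem exists_indecomposable_summand {K N : Type u} [AddCommGroup K] [Module H K]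
    [IsArtinian H K] [AddCommGroup N] [Module H N] {t : N →ₗ[H] K} (ht : t ≠ 0) :
    ∃ r : Module.End H K, r * r = r ∧ r ∘ₗ t ≠ 0 ∧ IsIndecomposable H (LinearMap.range r) := by
  obtain ⟨-, ⟨r, rfl, hr, hrt⟩, hmin⟩ := WellFounded.has_min
    (wellFounded_lt (α := Submodule H K))
    {S | ∃ r : Module.End H K, S = LinearMap.range r ∧ r * r = r ∧ r ∘ₗ t ≠ 0}
    ⟨_, 1, rfl, mul_one 1, ht⟩
  refine ⟨r, hr, hrt, ?_⟩
  have hr' : ∀ y, r (r y) = r y := LinearMap.congr_fun hr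
  have hfix : ∀ y : LinearMap.range r, r y = y := by
    rintro ⟨_, y, rfl⟩
    exact hr' y
  have hnt : Nontrivial (LinearMap.range r) := by
    by_contra h
    rw [not_nontrivial_iff_subsingleton] at h
    exact hrt (LinearMap.ext fun x => congrArg Subtype.val
      (Subsingleton.elim (⟨r (t x), t x, rfl⟩ : LinearMap.range r) 0))
  have key : ∀ f : Module.End H (LinearMap.range r), f * f = f →
      ((LinearMap.range r).subtype ∘ₗ f ∘ₗ r.rangeRestrict) ∘ₗ t ≠ 0 → f = 1 := by
    intro f hf hft
    let r' : Module.End H K := (LinearMap.range r).subtype ∘ₗ f ∘ₗ r.rangeRestrict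
    have hres : ∀ y : LinearMap.range r, r.rangeRestrict y = y := fun y => Subtype.ext (hfix y)
    have hf' : ∀ y, f (f y) = f y := LinearMap.congr_fun hf
    have hle : LinearMap.range r' ≤ LinearMap.range r := by
      rintro _ ⟨y, rfl⟩
      exact (f (r.rangeRestrict y)).2
    have hge : LinearMap.range r ≤ LinearMap.range r' := by
      by_contra h
      refine hmin _ ⟨r', rfl, LinearMap.ext fun y => ?_, hft⟩ (lt_of_le_not_ge hle h)
      change (f (r.rangeRestrict (f (r.rangeRestrict y))) : K) = f (r.rangeRestrict y)
      rw [hres, hf']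
    refine LinearMap.ext fun y => Subtype.ext ?_
    obtain ⟨z, hz⟩ := hge y.2
    have h1 : f (r.rangeRestrict z) = y := Subtype.ext hz
    rw [← h1, hf']
    rfl
  -- The two complementary components of r ∘ t under f and 1 - f cannot both vanish, so minimality
  -- makes one of f, 1 - f the identity.
  refine isIndecomposable_of_isIdempotentElem fun f hf => ?_
  by_cases h : ((LinearMap.range r).subtype ∘ₗ f ∘ₗ r.rangeRestrict) ∘ₗ t = 0
  · left
    have h1 := key (1 - f) (IsIdempotentElem.one_sub hf) fun h' => hrt (LinearMap.ext fun x => by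
      have h2 := LinearMap.congr_fun h x
      have h3 := LinearMap.congr_fun h' x
      change (f (r.rangeRestrict (t x)) : K) = 0 at h2
      change ((r.rangeRestrict (t x) - f (r.rangeRestrict (t x)) : LinearMap.range r) : K) = 0
        at h3
      rwa [Submodule.coe_sub, h2, sub_zero] at h3)
    simpa using h1
  · exact Or.inr (key f hf h)

/-- An indecomposable module of finite length with self-extensions contains a brick with
self-extensions. -/
theorem exists_brick (he : IsTriangular A e) {X : Type u} [AddCommGroup X] [Module H X]
    [IsNoetherian H X] [IsArtinian H X] [IsSemisimpleModule A X] (hX : IsIndecomposable H X)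
    (hext : ¬ ExtZero A X X) : ∃ B : Submodule H X, IsBrick H B ∧ ¬ ExtZero A B B := by
  have hss : ∀ N : Submodule H X, IsSemisimpleModule A N := isSemisimpleModule_submodule
  obtain ⟨N, ⟨hN, hNext⟩, hmin⟩ := WellFounded.has_min (wellFounded_lt (α := Submodule H X))
    {N | IsIndecomposable H N ∧ ¬ ExtZero A N N}
    ⟨⊤, hX.of_equiv Submodule.topEquiv.symm, fun h => hext (h.congr he Submodule.topEquiv)⟩
  refine ⟨N, ⟨hN.1, ?_⟩, hNext⟩
  by_contra! hb
  obtain ⟨-, ⟨θ, rfl, hθ0, hθb⟩, hmax⟩ := WellFounded.has_min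
    (wellFounded_gt (α := Submodule H N))
    {S | ∃ θ : Module.End H N, S = LinearMap.ker θ ∧ θ ≠ 0 ∧ ¬ Function.Bijective θ}
    (by obtain ⟨θ, h0, h1⟩ := hb; exact ⟨_, θ, rfl, h0, h1⟩)
  have hker : LinearMap.ker θ ≠ ⊥ := fun h => hθb
    ⟨LinearMap.ker_eq_bot.1 h,
      IsArtinian.surjective_of_injective_endomorphism θ (LinearMap.ker_eq_bot.1 h)⟩
  -- Non-bijectivity of ψ is automatic, since its kernel contains the nonzero ker θ.
  have hmax' : ∀ ψ : Module.End H N, ψ ≠ 0 → LinearMap.ker θ ≤ LinearMap.ker ψ →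
      LinearMap.ker ψ = LinearMap.ker θ := by
    intro ψ hψ hle
    by_contra hne
    refine hmax _ ⟨ψ, rfl, hψ, fun h => hker ?_⟩ (lt_of_le_of_ne hle (Ne.symm hne))
    rw [eq_bot_iff]
    exact hle.trans (LinearMap.ker_eq_bot.2 h.1).le
  have hsq := comp_self_eq_zero_of_maximal_ker hN hθ0 hθb hmax'
  let K := LinearMap.ker θ
  let t : N →ₗ[H] K := θ.codRestrict K hsq
  have ht : t ≠ 0 := fun h => hθ0 (LinearMap.ext fun x =>
    congrArg Subtype.val (LinearMap.congr_fun h x))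
  obtain ⟨r, hr, hrt, hind⟩ := exists_indecomposable_summand ht
  let C := LinearMap.range r
  let j : C →ₗ[H] N := K.subtype ∘ₗ C.subtype
  have hj : Function.Injective j := K.injective_subtype.comp C.injective_subtype
  have hjs : ¬ Function.Surjective j := by
    intro h
    refine hθ0 (LinearMap.ext fun x => ?_)
    obtain ⟨y, rfl⟩ := h x
    exact (C.subtype y).2
  -- the summand has self-extensions
  have hCext : ¬ ExtZero A C C := by
    intro hC
    have hKss : IsSemisimpleModule A K := isSemisimpleModule_submodule K
    have hCss : IsSemisimpleModule A C := isSemisimpleModule_submodule C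
    let ρ : K →ₗ[H] C := r.rangeRestrict
    let incl : LinearMap.range θ →ₗ[H] K := (LinearMap.range θ).subtype.codRestrict K (by
      rintro ⟨_, x, rfl⟩
      exact hsq x)
    let f : LinearMap.range θ →ₗ[H] C := ρ ∘ₗ incl
    -- Since r ∘ t is nonzero and kills ker θ, maximality gives ker (r ∘ t) = ker θ; hence the image
    -- of θ embeds in C.
    have hf : Function.Injective f := by
      refine (injective_iff_map_eq_zero f).2 ?_
      rintro ⟨_, x, rfl⟩ hx
      have hx : ρ (t x) = 0 := hx
      have h1 := hmax' (K.subtype ∘ₗ r ∘ₗ t)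
        (fun h => hrt (LinearMap.ext fun y => Subtype.ext (LinearMap.congr_fun h y)))
        (fun y hy => by
          have : t y = 0 := Subtype.ext hy
          rw [LinearMap.mem_ker, LinearMap.comp_apply, LinearMap.comp_apply, this, map_zero,
            map_zero])
      have h2 : x ∈ LinearMap.ker (K.subtype ∘ₗ r ∘ₗ t) :=
        congrArg (fun y : C => ((y : K) : N)) hx
      rw [h1] at h2
      exact Subtype.ext h2
    -- Extensions of the image of θ by C now split over H as soon as they split over A, so the
    -- projection K → C extends over 0 → K → N → θN → 0. This makes C a proper nonzero summand of
    -- the indecomposable N.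
    have h1 := hC.of_injective he f hf
    obtain ⟨P, hP⟩ := h1.exists_extension θ.rangeRestrict θ.surjective_rangeRestrict (K := K)
      (fun x => ⟨fun h => Subtype.ext h, fun h => congrArg Subtype.val h⟩) ρ
    have hCnt : Nontrivial C := hind.1
    have hPj : P ∘ₗ j = LinearMap.id := by
      refine LinearMap.ext fun y => (hP (C.subtype y)).trans ?_
      obtain ⟨_, z, rfl⟩ := y
      exact Subtype.ext (LinearMap.congr_fun hr z)
    have hbij := IsIndecomposable.bijective_of_retraction (M := N) (N := C) hN j P hPj
    exact hjs hbij.2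
  let E := (LinearEquiv.ofInjective (N.subtype ∘ₗ j) (N.injective_subtype.comp hj))
  refine hmin (LinearMap.range (N.subtype ∘ₗ j)) ⟨hind.of_equiv E, fun h => hCext ?_⟩ ?_
  · exact h.congr he E.symm
  · refine lt_of_le_not_ge ?_ fun h => hjs fun x => ?_
    · rintro _ ⟨x, rfl⟩
      exact (j x).2
    · obtain ⟨y, hy⟩ := h x.2
      exact ⟨y, Subtype.ext hy⟩

/-- Iterated self-extensions of a brick `B`: a module `X` whose length is a prescribed multiple of
that of `B`, all maps from `B` to which have the same image, and which has the property that each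
nonzero map from it has the image of a nonzero map from `B` in its range. -/
theorem exists_iterated_extension (he : IsTriangular A e) {B : Type u} [AddCommGroup B]
    [Module H B] [IsNoetherian H B] [IsArtinian H B] [IsSemisimpleModule A B] (hB : IsBrick H B)
    (hext : ¬ ExtZero A B B) (n : ℕ) :
    ∃ (X : ModuleCat.{u} H) (_ : IsNoetherian H X) (_ : IsArtinian H X)
      (_ : IsSemisimpleModule A X) (i : B →ₗ[H] X) (q : X →ₗ[H] B), Function.Injective i ∧
      Function.Surjective q ∧ (∀ g : B →ₗ[H] X, ∃ d : Module.End H B, g = i ∘ₗ d) ∧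
      (∀ (U : ModuleCat.{u} H) (f : X →ₗ[H] U), f ≠ 0 →
        ∃ g : B →ₗ[H] U, g ≠ 0 ∧ LinearMap.range g ≤ LinearMap.range f) ∧
      Module.length H X = (n + 1) * Module.length H B := by
  induction n with
  | zero =>
    refine ⟨ModuleCat.of H B, inferInstanceAs (IsNoetherian H B), inferInstanceAs (IsArtinian H B),
      inferInstanceAs (IsSemisimpleModule A B), LinearMap.id, LinearMap.id, fun _ _ h => h,
      fun x => ⟨x, rfl⟩, fun g => ⟨g, rfl⟩, fun U f hf => ⟨f, hf, le_rfl⟩, ?_⟩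
    simp
  | succ n ih =>
    obtain ⟨X, _, _, _, i, q, hi, hq, hhom, hgen, hlen⟩ := ih
    -- The quotient q : X → B turns vanishing for (B, X) into vanishing for (B, B), so a non-split
    -- extension of B by X exists. It is the next module.
    have hBX : ¬ ExtZero A B X := fun h => hext (h.of_surjective he q hq)
    rw [ExtZero] at hBX
    push Not at hBX
    obtain ⟨δ, hδ, hinner⟩ := hBX
    have hinner' : ¬ ∃ h : B →+ X, ∀ r x, δ r x = r • h x - h (r • x) := by
      push Not
      exact hinner
    have hex := Twist.exact hδ
    have hrk : LinearMap.range (Twist.inl hδ) = LinearMap.ker (Twist.snd hδ) :=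
      (LinearMap.exact_iff.1 hex).symm
    refine ⟨ModuleCat.of H (Twist A δ hδ), isNoetherian_of_range_eq_ker _ _ hrk,
      isArtinian_of_range_eq_ker _ _ hrk, Twist.isSemisimpleModule hδ, Twist.inl hδ ∘ₗ i,
      Twist.snd hδ, (Twist.inl_injective hδ).comp hi, Twist.snd_surjective hδ, ?_, ?_, ?_⟩
    · intro g
      -- A map from B to the extension has zero or bijective component in B. Zero means that it
      -- lands in X; bijective would split the extension.
      rcases hB.2 (Twist.snd hδ ∘ₗ g) with h | h
      · have h' : ∀ b, (g b).2 = 0 := LinearMap.congr_fun h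
        let g' : B →ₗ[H] X :=
          { toFun := fun b => (g b).1
            map_add' := fun b b' => by rw [map_add]; rfl
            map_smul' := fun r b => by
              rw [map_smul]
              refine (Twist.smul_fst hδ r (g b)).trans ?_
              rw [h', map_zero, add_zero, RingHom.id_apply] }
        obtain ⟨d, hd⟩ := hhom g'
        refine ⟨d, LinearMap.ext fun b => ?_⟩
        have h1 : g' b = i (d b) := LinearMap.congr_fun hd b
        exact Prod.ext h1 (h' b)
      · let E := LinearEquiv.ofBijective _ h
        exact (Twist.not_section hδ hinner' (g ∘ₗ E.symm.toLinearMap) fun b =>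
          E.apply_symm_apply b).elim
    · intro U f hf
      by_cases hfi : f ∘ₗ Twist.inl hδ = 0
      · obtain ⟨v, hv⟩ := exists_factor (Twist.snd_surjective hδ) f fun x hx => by
          obtain ⟨y, rfl⟩ := (hex x).1 hx
          exact LinearMap.congr_fun hfi y
        refine ⟨v, ?_, ?_⟩
        · rintro rfl
          exact hf (LinearMap.ext fun x => (hv x).symm)
        · rintro _ ⟨b, rfl⟩
          obtain ⟨x, rfl⟩ := Twist.snd_surjective hδ b
          exact ⟨x, (hv x).symm⟩
      · obtain ⟨g, hg, hgf⟩ := hgen U (f ∘ₗ Twist.inl hδ) hfi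
        exact ⟨g, hg, hgf.trans (LinearMap.range_comp_le_range _ _)⟩
    · have h1 := Module.length_eq_add_of_exact (Twist.inl hδ) (Twist.snd hδ)
        (Twist.inl_injective hδ) (Twist.snd_surjective hδ) hex
      refine h1.trans ?_
      rw [hlen]
      push_cast
      ring

/-- A brick with self-extensions gives indecomposable modules of arbitrarily large length. -/
theorem exists_indecomposable_length (he : IsTriangular A e) {B : Type u} [AddCommGroup B]
    [Module H B] [IsNoetherian H B] [IsArtinian H B] [IsSemisimpleModule A B] (hB : IsBrick H B)
    (hext : ¬ ExtZero A B B) (n : ℕ) :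
    ∃ (X : ModuleCat.{u} H) (_ : IsNoetherian H X) (_ : IsArtinian H X)
      (_ : IsSemisimpleModule A X) (i : B →ₗ[H] X), Function.Injective i ∧
      IsIndecomposable H X ∧ Module.length H X = (n + 1) * Module.length H B := by
  obtain ⟨X, h₁, h₂, h₃, i, q, hi, -, hhom, hgen, hlen⟩ := exists_iterated_extension he hB hext n
  refine ⟨X, h₁, h₂, h₃, i, hi, ⟨?_, fun U V hUV => ?_⟩, hlen⟩
  · have := hB.1
    exact hi.nontrivial
  -- The projection to a nonzero summand U has the image of a nonzero map B → X in its range. That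
  -- map is i followed after an automorphism of B, so U contains the image of i. Two complementary
  -- nonzero summands cannot both do so.
  have key : ∀ U V : Submodule H X, ∀ h : IsCompl U V, U ≠ ⊥ → LinearMap.range i ≤ U := by
    intro U V hUV hU
    let p : X →ₗ[H] X := U.subtype ∘ₗ U.projectionOnto V hUV
    have hp : p ≠ 0 := fun h => hU (by
      rw [eq_bot_iff]
      intro x hx
      have h1 := LinearMap.congr_fun h x
      have h2 : p x = x := congrArg Subtype.val (Submodule.projectionOnto_apply_left hUV ⟨x, hx⟩)
      rw [h2] at h1
      exact h1)
    obtain ⟨g, hg, hgp⟩ := hgen X p hp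
    obtain ⟨d, rfl⟩ := hhom g
    have hd : Function.Bijective d := (hB.2 d).resolve_left (by
      rintro rfl
      exact hg (LinearMap.comp_zero i))
    rintro _ ⟨b, rfl⟩
    obtain ⟨b, rfl⟩ := hd.2 b
    obtain ⟨y, hy⟩ := hgp ⟨b, rfl⟩
    have hy : p y = i (d b) := hy
    rw [← hy]
    exact (U.projectionOnto V hUV y).2
  by_contra! h
  have h1 := le_inf (key U V hUV h.1) (key V U hUV.symm h.2)
  rw [hUV.inf_eq_bot, le_bot_iff, LinearMap.range_eq_bot] at h1
  obtain ⟨b, hb⟩ := @exists_ne B hB.1 0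
  exact hb (hi (by rw [h1]; rfl))

end Bricks

/-! ### The separated ring and its diagonal -/

section SeparatedRing

variable (Λ : Type u) [Ring Λ]

/-- The triangular matrix ring with `Λ` on the diagonal and the radical below it. -/
def sepSubring : Subring (Matrix (Fin 2) (Fin 2) Λ) where
  carrier := {m | m 0 1 = 0 ∧ m 1 0 ∈ Ring.jacobson Λ}
  mul_mem' := by
    rintro m m' ⟨h, hx⟩ ⟨h', hx'⟩
    refine ⟨?_, ?_⟩
    · simp [Matrix.mul_apply, Fin.sum_univ_two, h, h']
    · rw [Matrix.mul_apply, Fin.sum_univ_two]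
      exact add_mem (Ideal.mul_mem_right _ _ hx) (Ideal.mul_mem_left _ _ hx')
  one_mem' := ⟨by simp, by simp⟩
  add_mem' := by
    rintro m m' ⟨h, hx⟩ ⟨h', hx'⟩
    exact ⟨by simp [h, h'], add_mem hx hx'⟩
  zero_mem' := ⟨rfl, zero_mem _⟩
  neg_mem' := by
    rintro m ⟨h, hx⟩
    exact ⟨by simp [h], neg_mem hx⟩

/-- The separated ring of `Λ`. -/
abbrev Sep : Type u := sepSubring Λ

variable {Λ}

namespace Sep

/-- The matrix with diagonal entries `a`, `b` and lower left entry `x`. -/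
def mk (a b : Λ) (x : Ring.jacobson Λ) : Sep Λ := ⟨!![a, 0; x, b], rfl, x.2⟩

/-- The upper left entry. -/
def a (s : Sep Λ) : Λ := s.1 0 0

/-- The lower right entry. -/
def b (s : Sep Λ) : Λ := s.1 1 1

/-- The lower left entry. -/
def x (s : Sep Λ) : Ring.jacobson Λ := ⟨s.1 1 0, s.2.2⟩

@[ext] theorem ext {s t : Sep Λ} (ha : s.a = t.a) (hb : s.b = t.b) (hx : s.x = t.x) : s = t := by
  apply Subtype.ext
  ext i j
  fin_cases i <;> fin_cases j
  · exact ha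
  · exact s.2.1.trans t.2.1.symm
  · exact congrArg Subtype.val hx
  · exact hb

@[simp] theorem a_mk (a b : Λ) (x : Ring.jacobson Λ) : (mk a b x).a = a := rfl
@[simp] theorem b_mk (a b : Λ) (x : Ring.jacobson Λ) : (mk a b x).b = b := rfl
@[simp] theorem x_mk (a b : Λ) (x : Ring.jacobson Λ) : (mk a b x).x = x := rfl
@[simp] theorem a_one : (1 : Sep Λ).a = 1 := rfl
@[simp] theorem b_one : (1 : Sep Λ).b = 1 := rfl
@[simp] theorem x_one : (1 : Sep Λ).x = 0 := rfl
@[simp] theorem a_zero : (0 : Sep Λ).a = 0 := rfl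
@[simp] theorem b_zero : (0 : Sep Λ).b = 0 := rfl
@[simp] theorem x_zero : (0 : Sep Λ).x = 0 := rfl
@[simp] theorem a_add (s t : Sep Λ) : (s + t).a = s.a + t.a := rfl
@[simp] theorem b_add (s t : Sep Λ) : (s + t).b = s.b + t.b := rfl
@[simp] theorem x_add (s t : Sep Λ) : (s + t).x = s.x + t.x := rfl
@[simp] theorem a_sub (s t : Sep Λ) : (s - t).a = s.a - t.a := rfl
@[simp] theorem b_sub (s t : Sep Λ) : (s - t).b = s.b - t.b := rfl
@[simp] theorem x_sub (s t : Sep Λ) : (s - t).x = s.x - t.x := rfl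

@[simp] theorem a_mul (s t : Sep Λ) : (s * t).a = s.a * t.a := by
  change (s.1 * t.1) 0 0 = _
  rw [Matrix.mul_apply, Fin.sum_univ_two, s.2.1, zero_mul, add_zero]
  rfl

@[simp] theorem b_mul (s t : Sep Λ) : (s * t).b = s.b * t.b := by
  change (s.1 * t.1) 1 1 = _
  rw [Matrix.mul_apply, Fin.sum_univ_two, t.2.1, mul_zero, zero_add]
  rfl

@[simp] theorem coe_x_mul (s t : Sep Λ) : ((s * t).x : Λ) = s.x * t.a + s.b * t.x := by
  change (s.1 * t.1) 1 0 = _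
  rw [Matrix.mul_apply, Fin.sum_univ_two]
  rfl

/-- The diagonal subring. -/
def diag (Λ : Type u) [Ring Λ] : Subring (Sep Λ) where
  carrier := {s | s.x = 0}
  mul_mem' := by
    intro s t (hs : s.x = 0) (ht : t.x = 0)
    exact Subtype.ext (by simp [hs, ht])
  one_mem' := rfl
  add_mem' := by
    intro s t (hs : s.x = 0) (ht : t.x = 0)
    change (s + t).x = 0
    rw [x_add, hs, ht, add_zero]
  zero_mem' := rfl
  neg_mem' := by
    intro s (hs : s.x = 0)
    exact Subtype.ext (by
      have := congrArg Subtype.val hs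
      change -(s.x : Λ) = 0
      rw [this]
      simp)

theorem mem_diag {s : Sep Λ} : s ∈ diag Λ ↔ s.x = 0 := Iff.rfl

/-- The second diagonal idempotent. -/
def e (Λ : Type u) [Ring Λ] : Sep Λ := mk 0 1 0

theorem isTriangular : IsTriangular (diag Λ) (e Λ) where
  mem := rfl
  mul_mem r := Subtype.ext (by simp [e])
  one_sub_mul_mem r := Subtype.ext (by simp [e])

/-- The diagonal embedding of `Λ`. -/
def scalar (Λ : Type u) [Ring Λ] : Λ →+* Sep Λ where
  toFun a := mk a a 0
  map_one' := by ext <;> simp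
  map_mul' a b := by ext <;> simp
  map_zero' := by ext <;> simp
  map_add' a b := by ext <;> simp

/-- A module on which the radical of the diagonal acts as zero is semisimple over the diagonal. -/
theorem isSemisimpleModule_diag [IsArtinianRing Λ] {X : Type*} [AddCommGroup X] [Module (Sep Λ) X]
    (h : ∀ a ∈ Ring.jacobson Λ, ∀ b ∈ Ring.jacobson Λ, ∀ v : X, mk a b 0 • v = 0) :
    IsSemisimpleModule (diag Λ) X := by
  let S := Λ ⧸ Ring.jacobson Λ
  let π : Λ →+* S := Ideal.Quotient.mk _
  let f : diag Λ →+* S × S :=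
    { toFun := fun s => (π s.1.a, π s.1.b)
      map_one' := rfl
      map_mul' := fun s t => by
        change (π (s.1 * t.1).a, π (s.1 * t.1).b) = _
        rw [a_mul, b_mul, map_mul, map_mul]
        rfl
      map_zero' := rfl
      map_add' := fun s t => by
        change (π (s.1.a + t.1.a), π (s.1.b + t.1.b)) = _
        rw [map_add, map_add]
        rfl }
  have hf : Function.Surjective f := by
    rintro ⟨a, b⟩
    obtain ⟨a, rfl⟩ := Ideal.Quotient.mk_surjective a
    obtain ⟨b, rfl⟩ := Ideal.Quotient.mk_surjective b
    exact ⟨⟨mk a b 0, rfl⟩, rfl⟩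
  have hss : IsSemisimpleRing (diag Λ ⧸ RingHom.ker f) :=
    (RingHom.quotientKerEquivOfSurjective hf).symm.isSemisimpleRing
  have ht : Module.IsTorsionBySet (diag Λ) X (RingHom.ker f) := by
    rintro v ⟨⟨s, hs⟩, hsf⟩
    have h1 : π s.a = 0 := congrArg Prod.fst hsf
    have h2 : π s.b = 0 := congrArg Prod.snd hsf
    have h3 : s = mk s.a s.b 0 := by
      ext
      · rfl
      · rfl
      · rw [mem_diag.1 hs]; rfl
    change s • v = 0
    rw [h3]
    exact h _ (Ideal.Quotient.eq_zero_iff_mem.1 h1) _ (Ideal.Quotient.eq_zero_iff_mem.1 h2) v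
  let := ht.module
  exact ht.isSemisimpleModule_iff.1 inferInstance

/-- Square zero elements of the diagonal coming from the radical kill modules semisimple over
the diagonal. -/
theorem diag_smul_eq_zero (hrad : IsRadicalSquareZero Λ) {X : Type*} [AddCommGroup X]
    [Module (Sep Λ) X] [IsSemisimpleModule (diag Λ) X] {a b : Λ} (ha : a ∈ Ring.jacobson Λ)
    (hb : b ∈ Ring.jacobson Λ) (v : X) : mk a b 0 • v = 0 := by
  -- N is the radical part of X. Radical diagonal elements kill N because J² = 0, and kill a
  -- complement C because they map it into N ∩ C.
  let N : Submodule (diag Λ) X := Submodule.span (diag Λ)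
    {y | ∃ a ∈ Ring.jacobson Λ, ∃ b ∈ Ring.jacobson Λ, ∃ x : X, mk a b 0 • x = y}
  obtain ⟨C, hC⟩ := exists_isCompl N
  have h1 : v ∈ N ⊔ C := hC.sup_eq_top ▸ trivial
  obtain ⟨n, hn, c, hc, rfl⟩ := Submodule.mem_sup.1 h1
  have h2 : mk a b 0 • n = 0 := by
    let T : Submodule (diag Λ) X :=
      { carrier := {y | ∀ a ∈ Ring.jacobson Λ, ∀ b ∈ Ring.jacobson Λ, mk a b 0 • y = 0}
        add_mem' := fun {y z} hy hz a ha b hb => by rw [smul_add, hy a ha b hb, hz a ha b hb,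
          add_zero]
        zero_mem' := fun a _ b _ => smul_zero _
        smul_mem' := by
          rintro ⟨s, hs⟩ y hy a ha b hb
          change mk a b 0 • s • y = 0
          rw [smul_smul, show mk a b 0 * s = mk (a * s.a) (b * s.b) 0 by
            ext <;> simp [mem_diag.1 hs]]
          exact hy _ (Ideal.mul_mem_right _ _ ha) _ (Ideal.mul_mem_right _ _ hb) }
    refine (Submodule.span_le (p := T)).2 ?_ hn a ha b hb
    rintro _ ⟨a', ha', b', hb', x, rfl⟩ a ha b hb
    rw [smul_smul, show mk a b 0 * mk a' b' 0 = 0 by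
      ext <;> simp [hrad a ha a' ha', hrad b hb b' hb'], zero_smul]
  have h3 : mk a b 0 • c = 0 := by
    have h4 : mk a b 0 • c ∈ N := Submodule.subset_span ⟨a, ha, b, hb, c, rfl⟩
    have h5 : mk a b 0 • c ∈ C := C.smul_mem ⟨mk a b 0, rfl⟩ hc
    have h6 : mk a b 0 • c ∈ N ⊓ C := ⟨h4, h5⟩
    rwa [hC.inf_eq_bot] at h6
  rw [smul_add, h2, h3, add_zero]

end Sep

end SeparatedRing

/-! ### The separated module M/JM × JM -/

section SeparatedModule

variable {Λ : Type u} [Ring Λ]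

/-- Linear maps on `JM` agree if they agree on products. -/
theorem rad_hom_ext {M : Type*} [AddCommGroup M] [Module Λ M] {N : Type*} [AddCommGroup N]
    [Module Λ N] {f g : rad Λ M →ₗ[Λ] N}
    (h : ∀ (a : Ring.jacobson Λ) (m : M),
      f ⟨(a : Λ) • m, smul_mem_rad a.2 m⟩ = g ⟨(a : Λ) • m, smul_mem_rad a.2 m⟩) : f = g := by
  have : rad Λ M ≤ (LinearMap.eqLocus f g).map (rad Λ M).subtype :=
    rad_le_of_smul_mem fun a ha m => ⟨⟨a • m, smul_mem_rad ha m⟩, h ⟨a, ha⟩ m, rfl⟩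
  refine LinearMap.ext fun y => ?_
  obtain ⟨z, hz, hzy⟩ := this y.2
  have : z = y := Subtype.ext hzy
  rwa [this] at hz

variable (hrad : IsRadicalSquareZero Λ)

section Act

variable {M : Type*} [AddCommGroup M] [Module Λ M]

/-- Multiplication by elements of the radical, as a map `M/JM → JM`. -/
def act (a : Ring.jacobson Λ) : (M ⧸ rad Λ M) →+ rad Λ M :=
  QuotientAddGroup.lift (rad Λ M).toAddSubgroup
    (AddMonoidHom.mk' (fun m => ⟨(a : Λ) • m, smul_mem_rad a.2 m⟩) fun m m' =>
      Subtype.ext (smul_add (a : Λ) m m'))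
    fun _ hm => Subtype.ext (smul_eq_zero_of_mem_rad hrad a.2 hm)

theorem act_mk (a : Ring.jacobson Λ) (m : M) :
    act hrad a (Submodule.Quotient.mk m : M ⧸ rad Λ M) = ⟨(a : Λ) • m, smul_mem_rad a.2 m⟩ := rfl

theorem act_add (a b : Ring.jacobson Λ) (v : M ⧸ rad Λ M) :
    act hrad (a + b) v = act hrad a v + act hrad b v := by
  obtain ⟨m, rfl⟩ := Submodule.Quotient.mk_surjective _ v
  exact Subtype.ext (add_smul (a : Λ) b m)

theorem act_zero (v : M ⧸ rad Λ M) : act hrad 0 v = 0 := by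
  obtain ⟨m, rfl⟩ := Submodule.Quotient.mk_surjective _ v
  exact Subtype.ext (zero_smul Λ m)

theorem act_x_mul (s t : Sep Λ) (v : M ⧸ rad Λ M) :
    act hrad (s * t).x v = act hrad s.x (t.a • v) + s.b • act hrad t.x v := by
  obtain ⟨m, rfl⟩ := Submodule.Quotient.mk_surjective _ v
  refine Subtype.ext ?_
  change ((s * t).x : Λ) • m = (s.x : Λ) • t.a • m + s.b • (t.x : Λ) • m
  rw [Sep.coe_x_mul, add_smul, mul_smul, mul_smul]

end Act

/-- The module `M/JM × JM` over the separated ring. -/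
@[nolint unusedArguments]
def Separated (_ : IsRadicalSquareZero Λ) (M : Type*) [AddCommGroup M] [Module Λ M] :=
  (M ⧸ rad Λ M) × rad Λ M

namespace Separated

variable {M N : Type*} [AddCommGroup M] [Module Λ M] [AddCommGroup N] [Module Λ N]

instance : AddCommGroup (Separated hrad M) :=
  inferInstanceAs (AddCommGroup ((M ⧸ rad Λ M) × rad Λ M))

instance : Module (Sep Λ) (Separated hrad M) where
  smul s z := (s.a • z.1, s.b • z.2 + act hrad s.x z.1)
  one_smul z := Prod.ext (one_smul Λ z.1) (by
    change (1 : Λ) • z.2 + act hrad 0 z.1 = z.2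
    rw [act_zero, one_smul, add_zero])
  mul_smul s t z := Prod.ext (by
    change (s * t).a • z.1 = s.a • t.a • z.1
    rw [Sep.a_mul, mul_smul]) (by
    change (s * t).b • z.2 + act hrad (s * t).x z.1 =
      s.b • (t.b • z.2 + act hrad t.x z.1) + act hrad s.x (t.a • z.1)
    rw [Sep.b_mul, act_x_mul, mul_smul, smul_add]
    abel)
  smul_zero s := Prod.ext (smul_zero s.a) (by
    change s.b • (0 : rad Λ M) + act hrad s.x 0 = 0
    rw [smul_zero, map_zero, add_zero])
  smul_add s z z' := Prod.ext (smul_add s.a z.1 z'.1) (by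
    change s.b • (z.2 + z'.2) + act hrad s.x (z.1 + z'.1) =
      (s.b • z.2 + act hrad s.x z.1) + (s.b • z'.2 + act hrad s.x z'.1)
    rw [smul_add, map_add]
    abel)
  add_smul s t z := Prod.ext (add_smul s.a t.a z.1) (by
    change (s.b + t.b) • z.2 + act hrad (s.x + t.x) z.1 =
      (s.b • z.2 + act hrad s.x z.1) + (t.b • z.2 + act hrad t.x z.1)
    rw [add_smul, act_add]
    abel)
  zero_smul z := Prod.ext (zero_smul Λ z.1) (by
    change (0 : Λ) • z.2 + act hrad 0 z.1 = 0
    rw [act_zero, zero_smul, add_zero])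

theorem smul_fst (s : Sep Λ) (z : Separated hrad M) : (s • z).1 = s.a • z.1 := rfl

theorem smul_snd (s : Sep Λ) (z : Separated hrad M) :
    (s • z).2 = s.b • z.2 + act hrad s.x z.1 := rfl

/-- The map induced by a linear map. -/
def map (f : M →ₗ[Λ] N) : Separated hrad M →ₗ[Sep Λ] Separated hrad N where
  toFun z := ((rad Λ M).mapQ (rad Λ N) f (fun _ hx => map_mem_rad f hx) z.1,
    ⟨f z.2, map_mem_rad f z.2.2⟩)
  map_add' z z' := Prod.ext (map_add _ z.1 z'.1) (Subtype.ext (map_add f (z.2 : M) z'.2))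
  map_smul' s z := Prod.ext (map_smul _ s.a z.1) (Subtype.ext (by
    obtain ⟨v, w⟩ := z
    obtain ⟨m, rfl⟩ := Submodule.Quotient.mk_surjective _ v
    change f (s.b • (w : M) + (s.x : Λ) • m) = s.b • f w + (s.x : Λ) • f m
    rw [map_add, map_smul, map_smul]))

theorem map_id : map hrad (LinearMap.id : M →ₗ[Λ] M) = LinearMap.id := by
  refine LinearMap.ext fun z => ?_
  obtain ⟨v, w⟩ := z
  obtain ⟨m, rfl⟩ := Submodule.Quotient.mk_surjective _ v
  rfl

theorem map_comp {L : Type*} [AddCommGroup L] [Module Λ L] (g : N →ₗ[Λ] L) (f : M →ₗ[Λ] N) :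
    map hrad (g ∘ₗ f) = map hrad g ∘ₗ map hrad f := by
  refine LinearMap.ext fun z => ?_
  obtain ⟨v, w⟩ := z
  obtain ⟨m, rfl⟩ := Submodule.Quotient.mk_surjective _ v
  rfl

theorem map_zero' : map hrad (0 : M →ₗ[Λ] N) = 0 := by
  refine LinearMap.ext fun z => ?_
  obtain ⟨v, w⟩ := z
  obtain ⟨m, rfl⟩ := Submodule.Quotient.mk_surjective _ v
  rfl

/-- The equivalence induced by a linear equivalence. -/
def mapEquiv (f : M ≃ₗ[Λ] N) : Separated hrad M ≃ₗ[Sep Λ] Separated hrad N :=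
  LinearEquiv.ofLinearMap (map hrad f.toLinearMap) (map hrad f.symm.toLinearMap)
    (by rw [← map_comp, f.comp_symm, map_id]) (by rw [← map_comp, f.symm_comp, map_id])

theorem isSemisimpleModule [IsArtinianRing Λ] :
    IsSemisimpleModule (Sep.diag Λ) (Separated hrad M) := by
  refine Sep.isSemisimpleModule_diag fun a ha b hb z => Prod.ext ?_ ?_
  · exact jacobson_smul_eq_zero ha z.1
  · change b • z.2 + act hrad 0 z.1 = 0
    rw [act_zero, add_zero]
    exact Subtype.ext (smul_eq_zero_of_mem_rad hrad hb z.2.2)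

/-- Restricted along the diagonal embedding of Λ, the separated module is the direct product of M/JM
and JM; chain conditions over Λ pass up to the larger ring. -/
theorem finite_length [IsNoetherian Λ M] [IsArtinian Λ M] :
    IsNoetherian (Sep Λ) (Separated hrad M) ∧ IsArtinian (Sep Λ) (Separated hrad M) := by
  let : Module Λ (Separated hrad M) := Module.compHom _ (Sep.scalar Λ)
  let : SMul Λ (Sep Λ) := ⟨fun c s => Sep.scalar Λ c * s⟩
  have : IsScalarTower Λ (Sep Λ) (Separated hrad M) :=
    ⟨fun c s z => mul_smul (Sep.scalar Λ c) s z⟩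
  let E : ((M ⧸ rad Λ M) × rad Λ M) ≃ₗ[Λ] Separated hrad M :=
    { toFun := fun z => z
      invFun := fun z => z
      map_add' := fun _ _ => rfl
      map_smul' := fun c z => Prod.ext rfl (by
        change c • z.2 = c • z.2 + act hrad 0 z.1
        rw [act_zero, add_zero])
      left_inv := fun _ => rfl
      right_inv := fun _ => rfl }
  have h1 : IsNoetherian Λ (Separated hrad M) := isNoetherian_of_linearEquiv E
  have h2 : IsArtinian Λ (Separated hrad M) := isArtinian_of_linearEquiv E
  exact ⟨isNoetherian_of_tower Λ h1, isArtinian_of_tower Λ h2⟩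

end Separated

end SeparatedModule

/-! ### Fullness of the separated module construction and indecomposability -/

section Full

variable {Λ : Type u} [Ring Λ] (hrad : IsRadicalSquareZero Λ)

namespace Separated

/-- The element with given components. -/
def mk {M : Type*} [AddCommGroup M] [Module Λ M] (v : M ⧸ rad Λ M) (w : rad Λ M) :
    Separated hrad M := (v, w)

theorem mk_smul_mk {M : Type*} [AddCommGroup M] [Module Λ M] (x : Ring.jacobson Λ)
    (v : M ⧸ rad Λ M) : Sep.mk 0 0 x • mk hrad v 0 = mk hrad 0 (act hrad x v) :=
  Prod.ext (zero_smul Λ v) (by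
    change (0 : Λ) • (0 : rad Λ M) + act hrad x v = act hrad x v
    rw [smul_zero, zero_add])

/-- A diagonal-linear map between separated modules is given by its two components. -/
theorem exists_components_of_diag {M N : Type*} [AddCommGroup M] [Module Λ M] [AddCommGroup N]
    [Module Λ N] (h : Separated hrad M →+ Separated hrad N)
    (hd : ∀ s ∈ Sep.diag Λ, ∀ z, h (s • z) = s • h z) :
    ∃ (a : (M ⧸ rad Λ M) →ₗ[Λ] N ⧸ rad Λ N) (b : rad Λ M →ₗ[Λ] rad Λ N),
      ∀ z, h z = (a z.1, b z.2) := by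
  have hs1 : ∀ (c : Λ) (v : M ⧸ rad Λ M),
      (Sep.mk c 0 0 • mk hrad v 0) = mk hrad (c • v) 0 :=
    fun c v => Prod.ext rfl (by
      change (0 : Λ) • (0 : rad Λ M) + act hrad 0 v = 0
      rw [act_zero, smul_zero, add_zero])
  have hs2 : ∀ (c : Λ) (w : rad Λ M),
      (Sep.mk 0 c 0 • mk hrad 0 w) = mk hrad 0 (c • w) :=
    fun c w => Prod.ext (smul_zero (0 : Λ)) (by
      change c • w + act hrad 0 0 = c • w
      rw [act_zero, add_zero])
  have h1 : ∀ (c : Λ) v, h (mk hrad (c • v) 0) = Sep.mk c 0 0 • h (mk hrad v 0) := fun c v => by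
    rw [← hd _ rfl, hs1]
  have h2 : ∀ (c : Λ) w, h (mk hrad 0 (c • w)) = Sep.mk 0 c 0 • h (mk hrad 0 w) := fun c w => by
    rw [← hd _ rfl, hs2]
  have h10 : ∀ v, (h (mk hrad v 0)).2 = 0 := fun v => by
    have h3 := h1 1 v
    rw [one_smul] at h3
    rw [h3, smul_snd]
    change (0 : Λ) • _ + act hrad 0 _ = 0
    rw [zero_smul, act_zero, add_zero]
  have h20 : ∀ w, (h (mk hrad 0 w)).1 = 0 := fun w => by
    have h3 := h2 1 w
    rw [one_smul] at h3
    rw [h3, smul_fst]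
    exact zero_smul Λ _
  refine ⟨{ toFun := fun v => (h (mk hrad v 0)).1
            map_add' := fun v v' => ?_
            map_smul' := fun c v => ?_ },
          { toFun := fun w => (h (mk hrad 0 w)).2
            map_add' := fun w w' => ?_
            map_smul' := fun c w => ?_ }, fun z => ?_⟩
  · have : mk hrad (v + v') 0 = mk hrad v 0 + mk hrad v' 0 :=
      Prod.ext rfl (add_zero (0 : rad Λ M)).symm
    rw [this, map_add]
    rfl
  · rw [h1]
    rfl
  · have : mk hrad 0 (w + w') = mk hrad 0 w + mk hrad 0 w' :=
      Prod.ext (add_zero (0 : M ⧸ rad Λ M)).symm rfl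
    rw [this, map_add]
    rfl
  · rw [h2, smul_snd]
    change c • _ + act hrad 0 _ = _
    rw [act_zero, add_zero]
    rfl
  · have : z = mk hrad z.1 0 + mk hrad 0 z.2 :=
      Prod.ext (add_zero z.1).symm (zero_add z.2).symm
    conv_lhs => rw [this, map_add]
    refine Prod.ext ?_ ?_
    · exact (congrArg (_ + ·) (h20 z.2)).trans (add_zero _)
    · exact (congrArg (· + _) (h10 z.1)).trans (zero_add _)

/-- The components a, b of k satisfy b(xv) = x a(v) for x in J. Lift a to g : P → N on a projective
cover of M. On rad P the map g equals b ∘ π, so it kills ker π ≤ rad P and descends to M. -/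
theorem map_surjective [IsArtinianRing Λ] {M : Type*} [AddCommGroup M] [Module Λ M]
    [Module.Finite Λ M] {N : Type*} [AddCommGroup N] [Module Λ N]
    (k : Separated hrad M →ₗ[Sep Λ] Separated hrad N) : ∃ f : M →ₗ[Λ] N, map hrad f = k := by
  obtain ⟨a, b, hab⟩ := exists_components_of_diag hrad k.toAddMonoidHom
    fun s _ z => k.map_smul s z
  have hk : ∀ z, k z = (a z.1, b z.2) := hab
  have hx : ∀ (x : Ring.jacobson Λ) (v : M ⧸ rad Λ M), b (act hrad x v) = act hrad x (a v) := by
    intro x v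
    have h1 := k.map_smul (Sep.mk 0 0 x) (mk hrad v 0)
    rw [mk_smul_mk, hk, hk] at h1
    have h3 := congrArg Prod.snd h1
    refine h3.trans ?_
    change (0 : Λ) • b 0 + act hrad x (a v) = _
    rw [zero_smul, zero_add]
  obtain ⟨P, π, hπ⟩ := exists_projectiveCover Λ M
  have := hπ.projective
  obtain ⟨g, hg⟩ := Module.projective_lifting_property (rad Λ N).mkQ
    (a ∘ₗ (rad Λ M).mkQ ∘ₗ π) (rad Λ N).mkQ_surjective
  have hg' : ∀ p, (Submodule.Quotient.mk (g p) : N ⧸ rad Λ N) =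
      a (Submodule.Quotient.mk (π p)) := LinearMap.congr_fun hg
  have hgr : g ∘ₗ (rad Λ P).subtype = (rad Λ N).subtype ∘ₗ b ∘ₗ
      (π ∘ₗ (rad Λ P).subtype).codRestrict (rad Λ M) (fun y => map_mem_rad π y.2) := by
    refine rad_hom_ext fun x p => ?_
    have h1 := hx x (Submodule.Quotient.mk (π p))
    rw [← hg', act_mk] at h1
    have h2 := congrArg Subtype.val h1
    have h3 : ((π ∘ₗ (rad Λ P).subtype).codRestrict (rad Λ M) (fun y => map_mem_rad π y.2)
        ⟨(x : Λ) • p, smul_mem_rad x.2 p⟩) = ⟨(x : Λ) • π p, smul_mem_rad x.2 _⟩ :=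
      Subtype.ext (map_smul π (x : Λ) p)
    rw [LinearMap.comp_apply, LinearMap.comp_apply, LinearMap.comp_apply, h3]
    exact (map_smul g (x : Λ) p).trans h2.symm
  obtain ⟨f, hf⟩ := exists_factor hπ.surjective g fun y hy => by
    have h1 := LinearMap.congr_fun hgr ⟨y, hπ.ker_le_rad hy⟩
    refine h1.trans ?_
    have h2 : ((π ∘ₗ (rad Λ P).subtype).codRestrict (rad Λ M) (fun y => map_mem_rad π y.2)
        ⟨y, hπ.ker_le_rad hy⟩) = 0 := Subtype.ext hy
    rw [LinearMap.comp_apply, LinearMap.comp_apply, h2, map_zero, map_zero]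
  have hfa : ∀ m, (Submodule.Quotient.mk (f m) : N ⧸ rad Λ N) = a (Submodule.Quotient.mk m) := by
    intro m
    obtain ⟨p, rfl⟩ := hπ.surjective m
    rw [hf, hg']
  have hfb : f ∘ₗ (rad Λ M).subtype = (rad Λ N).subtype ∘ₗ b := by
    refine rad_hom_ext fun x m => ?_
    have h1 := hx x (Submodule.Quotient.mk m)
    rw [← hfa, act_mk] at h1
    exact (map_smul f (x : Λ) m).trans (congrArg Subtype.val h1).symm
  refine ⟨f, LinearMap.ext fun z => ?_⟩
  obtain ⟨v, w⟩ := z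
  obtain ⟨m, rfl⟩ := Submodule.Quotient.mk_surjective _ v
  refine Eq.trans ?_ (hk _).symm
  exact Prod.ext (hfa m) (Subtype.ext (LinearMap.congr_fun hfb w))

/-- An idempotent of the separated module lifts to an endomorphism f of M, not necessarily
idempotent. By Fitting's lemma f is nilpotent or bijective, hence so is the idempotent, which is
therefore 0 or 1. -/
theorem isIndecomposable [IsArtinianRing Λ] {M : Type u} [AddCommGroup M] [Module Λ M]
    [Module.Finite Λ M] (hM : IsIndecomposable Λ M) :
    IsIndecomposable (Sep Λ) (Separated hrad M) := by
  have hMnt := hM.1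
  have hnt : Nontrivial (M ⧸ rad Λ M) := Submodule.Quotient.nontrivial_iff.2 fun h =>
    not_subsingleton M (subsingleton_of_rad_eq_top h)
  have hnt' : Nontrivial (Separated hrad M) :=
    inferInstanceAs (Nontrivial ((M ⧸ rad Λ M) × rad Λ M))
  refine isIndecomposable_of_isIdempotentElem fun k hk => ?_
  obtain ⟨f, rfl⟩ := map_surjective hrad k
  rcases hM.isNilpotent_or_bijective f with ⟨n, hn⟩ | hb
  · left
    have h1 : ∀ n : ℕ, map hrad (f ^ n) = map hrad f ^ n := by
      intro n
      induction n with
      | zero => exact map_id hrad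
      | succ n ih =>
        rw [pow_succ, pow_succ, ← ih]
        exact map_comp hrad (f ^ n) f
    have h2 := (h1 (n + 1)).symm
    rw [pow_succ f, hn, zero_mul, IsIdempotentElem.pow_succ_eq n hk] at h2
    exact h2.trans (map_zero' hrad)
  · right
    let E := LinearEquiv.ofBijective f hb
    have h1 : map hrad E.symm.toLinearMap ∘ₗ map hrad f = LinearMap.id := by
      rw [← map_comp, ← map_id hrad]
      congr 1
      exact E.symm_comp
    refine LinearMap.ext fun z => ?_
    have h2 := LinearMap.congr_fun hk z
    have h3 := congrArg (map hrad E.symm.toLinearMap) h2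
    have h4 : ∀ y, map hrad E.symm.toLinearMap (map hrad f y) = y := LinearMap.congr_fun h1
    exact (h4 _).symm.trans (h3.trans (h4 z))

/-- For an idempotent f, if f induces zero then it sends M into JM and kills JM, so f = f² = 0. If
it induces the identity, then f - 1 maps M into JM and f fixes JM; thus f(m) - m is fixed by f and
also killed by f. -/
theorem isIndecomposable_of_separated {M : Type u} [AddCommGroup M] [Module Λ M]
    (h : IsIndecomposable (Sep Λ) (Separated hrad M)) : IsIndecomposable Λ M := by
  have hnt : Nontrivial M := by
    by_contra hM
    rw [not_nontrivial_iff_subsingleton] at hM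
    have h0 := h.1
    obtain ⟨z, hz⟩ := exists_ne (0 : Separated hrad M)
    refine hz (Prod.ext ?_ (Subtype.ext (Subsingleton.elim _ _)))
    obtain ⟨m, hm⟩ := Submodule.Quotient.mk_surjective _ z.1
    rw [← hm, Subsingleton.elim m 0]
    rfl
  refine isIndecomposable_of_isIdempotentElem fun f hf => ?_
  have hff : ∀ m, f (f m) = f m := LinearMap.congr_fun hf
  have hF : map hrad f * map hrad f = map hrad f :=
    (map_comp hrad f f).symm.trans (congrArg _ hf)
  rcases h.eq_zero_or_eq_one _ hF with h0 | h0
  · left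
    refine LinearMap.ext fun m => ?_
    have h1 : f m ∈ rad Λ M := (Submodule.Quotient.mk_eq_zero _).1
      (congrArg Prod.fst (LinearMap.congr_fun h0 (Submodule.Quotient.mk m, 0)))
    have h2 := congrArg Prod.snd (LinearMap.congr_fun h0 (0, ⟨f m, h1⟩))
    have h3 : f (f m) = 0 := congrArg Subtype.val h2
    rw [← hff, h3]
    rfl
  · right
    refine LinearMap.ext fun m => ?_
    have h1 : f m - m ∈ rad Λ M := (Submodule.Quotient.eq _).1
      (congrArg Prod.fst (LinearMap.congr_fun h0 (Submodule.Quotient.mk m, 0)))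
    have h2 := congrArg Prod.snd (LinearMap.congr_fun h0 (0, ⟨f m - m, h1⟩))
    have h3 : f (f m - m) = f m - m := congrArg Subtype.val h2
    rw [map_sub, hff, sub_self] at h3
    exact sub_eq_zero.1 h3.symm

end Separated

end Full

/-! ### The obstruction to factoring a radical map -/

section Cocycle

variable {R : Type w} [CommRing R] [IsArtinianRing R] {Λ : Type u} [Ring Λ] [Algebra R Λ]
  [Module.Finite R Λ] {M : Type u} [AddCommGroup M] [Module Λ M] [Module.Finite Λ M]

/-- If the separated module of `M` has no self-extensions, radical maps `P₁(M) → M` factor through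
`P₁(M) → P₀(M)`. -/
theorem factors_of_extZero (hrad : IsRadicalSquareZero Λ)
    (hext : ExtZero (Sep.diag Λ) (Separated hrad M) (Separated hrad M))
    (f : P₁ R Λ M →ₗ[Λ] M) (hf : ∀ y, f y ∈ rad Λ M) :
    ∃ g : P₀ R Λ M →ₗ[Λ] M, g ∘ₗ differential R Λ M = f := by
  have hart : IsArtinianRing Λ := IsArtinianRing.of_finite R Λ
  let P := P₀ R Λ M
  let π : P →ₗ[Λ] M := cover R Λ M
  have hπ : IsProjectiveCover π := isProjectiveCover_cover R Λ M
  let Ω := Syzygy R Λ M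
  have hΩ : Ω ≤ rad Λ P := hπ.ker_le_rad
  obtain ⟨f', hf'⟩ : ∃ f' : Ω →ₗ[Λ] rad Λ M, ∀ y, f' (cover R Λ Ω y) = f.codRestrict _ hf y := by
    refine exists_factor (isProjectiveCover_cover R Λ Ω).surjective (f.codRestrict _ hf)
      fun y hy => ?_
    have h1 := map_mem_rad (f.codRestrict _ hf)
      ((isProjectiveCover_cover R Λ Ω).ker_le_rad hy)
    exact (Submodule.mem_bot Λ).1 (rad_le_of_smul_mem (N := ⊥) (fun a ha m =>
      (Submodule.mem_bot Λ).2 (Subtype.ext (smul_eq_zero_of_mem_rad hrad ha m.2))) h1)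
  have hss : IsSemisimpleModule Λ (rad Λ P) := isSemisimpleModule_of_jacobson_smul
    fun a ha v => Subtype.ext (smul_eq_zero_of_mem_rad hrad ha v.2)
  -- A radical f kills the kernel of the cover of the syzygy and so is a map f' on Ω; it extends to
  -- rad P because rad P is semisimple.
  obtain ⟨F, hF⟩ := IsSemisimpleModule.extension_property (Submodule.inclusion hΩ)
    (Submodule.inclusion_injective hΩ) f'
  let T : (P ⧸ rad Λ P) →ₗ[Λ] M ⧸ rad Λ M :=
    (rad Λ P).mapQ (rad Λ M) π fun _ hx => map_mem_rad π hx
  have hT : Function.Bijective T := by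
    refine ⟨?_, ?_⟩
    · refine (injective_iff_map_eq_zero T).2 fun v hv => ?_
      obtain ⟨p, rfl⟩ := Submodule.Quotient.mk_surjective _ v
      have hp : π p ∈ rad Λ M := (Submodule.Quotient.mk_eq_zero _).1 hv
      have h1 : rad Λ M ≤ (rad Λ P).map π := rad_le_of_smul_mem fun a ha m => by
        obtain ⟨p, rfl⟩ := hπ.surjective m
        exact ⟨a • p, smul_mem_rad ha p, map_smul π a p⟩
      obtain ⟨y, hy, hyp⟩ := h1 hp
      refine (Submodule.Quotient.mk_eq_zero _).2 ?_
      have h2 : p - y ∈ rad Λ P := hπ.ker_le_rad (by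
        rw [LinearMap.mem_ker, map_sub, hyp, sub_self])
      simpa using add_mem h2 hy
    · intro v
      obtain ⟨m, rfl⟩ := Submodule.Quotient.mk_surjective _ v
      obtain ⟨p, rfl⟩ := hπ.surjective m
      exact ⟨Submodule.Quotient.mk p, rfl⟩
  let E := LinearEquiv.ofBijective T hT
  have hE : ∀ p : P, E.symm (Submodule.Quotient.mk (π p)) = Submodule.Quotient.mk p := fun p =>
    E.symm_apply_eq.2 rfl
  -- P and M have the same top, via E, so F composed with the radical action on P/JP becomes a
  -- derivation with values in the lower component JM.
  let β (s : Sep Λ) (v : M ⧸ rad Λ M) : rad Λ M := F (act hrad s.x (E.symm v))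
  let δ : Sep Λ →+ Separated hrad M →+ Separated hrad M :=
    AddMonoidHom.mk' (fun s => AddMonoidHom.mk' (fun z => (0, β s z.1)) fun z z' =>
      Prod.ext (add_zero (0 : M ⧸ rad Λ M)).symm (by
        change F (act hrad s.x (E.symm (z.1 + z'.1))) = β s z.1 + β s z'.1
        rw [map_add, map_add, map_add])) fun s t => by
      ext z
      refine Prod.ext (add_zero (0 : M ⧸ rad Λ M)).symm ?_
      change F (act hrad (s.x + t.x) (E.symm z.1)) = β s z.1 + β t z.1
      rw [act_add, map_add]
  have hδ : IsDer (Sep.diag Λ) δ :=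
    { leibniz := fun s t z => Prod.ext
        (by
          change (0 : M ⧸ rad Λ M) = s.a • (0 : M ⧸ rad Λ M) + 0
          rw [smul_zero, add_zero])
        (by
          change F (act hrad (s * t).x (E.symm z.1)) =
            (s.b • F (act hrad t.x (E.symm z.1)) + act hrad s.x 0) +
              F (act hrad s.x (E.symm (t.a • z.1)))
          rw [act_x_mul, map_smul E.symm, map_add, map_smul F, map_zero, add_zero, add_comm])
      vanish := fun s hs => by
        ext z
        refine Prod.ext rfl ?_
        change F (act hrad s.x (E.symm z.1)) = 0
        rw [Sep.mem_diag.1 hs, act_zero, map_zero] }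
  obtain ⟨h, hh⟩ := hext δ hδ
  obtain ⟨a, b, hab⟩ := Separated.exists_components_of_diag hrad h fun s hs z => by
    have h1 := hh s z
    rw [hδ.vanish s hs] at h1
    exact (sub_eq_zero.1 h1.symm).symm
  have hx : ∀ (x : Ring.jacobson Λ) (v : M ⧸ rad Λ M),
      F (act hrad x (E.symm v)) = act hrad x (a v) - b (act hrad x v) := by
    intro x v
    have h1 := hh (Sep.mk 0 0 x) (Separated.mk hrad v 0)
    rw [Separated.mk_smul_mk, hab, hab] at h1
    refine (congrArg Prod.snd h1).trans ?_
    change ((0 : Λ) • b 0 + act hrad x (a v)) - b (act hrad x v) = _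
    rw [zero_smul, zero_add]
  have := hπ.projective
  obtain ⟨g, hg⟩ := Module.projective_lifting_property (rad Λ M).mkQ
    (a ∘ₗ (rad Λ M).mkQ ∘ₗ π) (rad Λ M).mkQ_surjective
  have hg' : ∀ p, (Submodule.Quotient.mk (g p) : M ⧸ rad Λ M) =
      a (Submodule.Quotient.mk (π p)) := LinearMap.congr_fun hg
  let πr : rad Λ P →ₗ[Λ] rad Λ M :=
    (π ∘ₗ (rad Λ P).subtype).codRestrict (rad Λ M) fun y => map_mem_rad π y.2
  -- Trivializing the derivation gives F(xp) = x a(p) - b(xπ(p)). With g a lift of a to P, this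
  -- reads F = g - b ∘ π on rad P. Since π vanishes on Ω, g restricts there to f'.
  have key : (rad Λ M).subtype ∘ₗ F =
      g ∘ₗ (rad Λ P).subtype - (rad Λ M).subtype ∘ₗ b ∘ₗ πr := by
    refine rad_hom_ext fun x p => ?_
    have h1 := hx x (Submodule.Quotient.mk (π p))
    rw [hE, ← hg', act_mk, act_mk, act_mk] at h1
    have h2 := congrArg Subtype.val h1
    have h3 : πr ⟨(x : Λ) • p, smul_mem_rad x.2 p⟩ = ⟨(x : Λ) • π p, smul_mem_rad x.2 _⟩ :=
      Subtype.ext (map_smul π (x : Λ) p)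
    refine h2.trans ?_
    rw [LinearMap.sub_apply, LinearMap.comp_apply, LinearMap.comp_apply, LinearMap.comp_apply, h3]
    exact congrArg₂ (· - ·) (map_smul g (x : Λ) p).symm rfl
  refine ⟨g, LinearMap.ext fun y => ?_⟩
  let z : Ω := cover R Λ Ω y
  have h1 : πr (Submodule.inclusion hΩ z) = 0 := Subtype.ext z.2
  have h2 := LinearMap.congr_fun key (Submodule.inclusion hΩ z)
  rw [LinearMap.sub_apply, LinearMap.comp_apply, LinearMap.comp_apply, LinearMap.comp_apply,
    LinearMap.comp_apply, h1, map_zero, map_zero, sub_zero] at h2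
  have h3 : F (Submodule.inclusion hΩ z) = f.codRestrict _ hf y :=
    (LinearMap.congr_fun hF z).trans (hf' y)
  rw [h3] at h2
  exact h2.symm

end Cocycle

/-- A nonzero submodule of an indecomposable module that contains all `(1 - e) • x` is the whole
module. -/
theorem IsIndecomposable.eq_top_of_one_sub_smul_mem {H : Type u} [Ring H] {A : Subring H} {e : H}
    (he : IsTriangular A e) {X : Type u} [AddCommGroup X] [Module H X] [IsSemisimpleModule A X]
    (hX : IsIndecomposable H X) {Y : Submodule H X} (hY : ∀ x : X, (1 - e) • x ∈ Y)
    (hne : Y ≠ ⊥) : Y = ⊤ := by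
  obtain ⟨C, hC⟩ := exists_isCompl (Y.restrictScalars A)
  -- For c in the A-complement C, (1 - e) • c lies in Y ∩ C = 0. So C is contained in eX, and r * e
  -- ∈ A makes it stable under all of H.
  have hc : ∀ c ∈ C, e • c = c := fun c hc => by
    have h1 : (1 - e) • c ∈ C := C.smul_mem ⟨1 - e, sub_mem A.one_mem he.mem⟩ hc
    have h2 : (1 - e) • c ∈ Y.restrictScalars A ⊓ C := ⟨hY c, h1⟩
    rw [hC.inf_eq_bot, Submodule.mem_bot, sub_smul, one_smul] at h2
    exact (sub_eq_zero.1 h2).symm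
  let D : Submodule H X :=
    { C.toAddSubmonoid with
      smul_mem' := fun r c h => by
        change r • c ∈ C
        rw [← hc c h, smul_smul]
        exact C.smul_mem ⟨r * e, he.mul_mem r⟩ h }
  have hD : IsCompl Y D := by
    refine ⟨?_, ?_⟩
    · rw [Submodule.disjoint_def]
      intro x hx hxD
      exact Submodule.disjoint_def.1 hC.disjoint x hx hxD
    · rw [codisjoint_iff, eq_top_iff]
      intro x _
      have h1 : x ∈ Y.restrictScalars A ⊔ C := hC.sup_eq_top ▸ trivial
      obtain ⟨y, hy, c, hc, rfl⟩ := Submodule.mem_sup.1 h1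
      exact Submodule.mem_sup.2 ⟨y, hy, c, hc, rfl⟩
  have h1 := (hX.2 Y D hD).resolve_left hne
  rw [← hD.sup_eq_top, h1, sup_bot_eq]

/-! ### Realizing modules over the separated ring; finite representation type -/

section Density

variable {Λ : Type u} [Ring Λ] [IsArtinianRing Λ] (hrad : IsRadicalSquareZero Λ)

/-- Indecomposable modules over the separated ring that are semisimple over the diagonal and not
concentrated in the lower component are separated modules of modules over `Λ`. -/
theorem exists_separated_equiv {X : Type u} [AddCommGroup X] [Module (Sep Λ) X]
    [IsNoetherian (Sep Λ) X] [IsSemisimpleModule (Sep.diag Λ) X]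
    (hX : IsIndecomposable (Sep Λ) X) {x₀ : X} (hx₀ : (1 - Sep.e Λ) • x₀ ≠ 0) :
    ∃ M : ModuleCat.{u} Λ, Module.Finite Λ M ∧
      Nonempty (Separated hrad M ≃ₗ[Sep Λ] X) := by
  let _ : Module Λ X := Module.compHom X (Sep.scalar Λ)
  have hsc : ∀ (c : Λ) (x : X), c • x = Sep.mk c c 0 • x := fun _ _ => rfl
  have he : (1 - Sep.e Λ) = Sep.mk (1 : Λ) 0 0 := by ext <;> simp [Sep.e]
  let U : X →ₗ[Λ] X :=
    { toFun := fun x => Sep.mk (1 : Λ) 0 0 • x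
      map_add' := smul_add _
      map_smul' := fun c x => by
        rw [RingHom.id_apply, hsc, hsc, smul_smul, smul_smul]
        congr 1
        ext <;> simp }
  have hU : ∀ x, U x = Sep.mk (1 : Λ) 0 0 • x := fun _ => rfl
  have hfin : Module.Finite Λ (LinearMap.range U) := by
    obtain ⟨S, hS⟩ := IsNoetherian.noetherian (⊤ : Submodule (Sep Λ) X)
    refine Module.Finite.of_fg ?_
    classical
    refine ⟨S.image U, le_antisymm (Submodule.span_le.2 ?_) ?_⟩
    · intro y hy
      obtain ⟨x, -, rfl⟩ := Finset.mem_image.1 hy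
      exact ⟨x, rfl⟩
    · rintro _ ⟨x, rfl⟩
      have hx : x ∈ Submodule.span (Sep Λ) (S : Set X) := hS ▸ trivial
      induction hx using Submodule.span_induction with
      | mem x hx => exact Submodule.subset_span (Finset.mem_coe.2 (Finset.mem_image_of_mem U hx))
      | zero => rw [map_zero]; exact zero_mem _
      | add x y _ _ hx hy => rw [map_add]; exact add_mem hx hy
      | smul s x _ hx =>
        have : U (s • x) = s.a • U x := by
          rw [hsc, hU, hU, smul_smul, smul_smul]
          congr 1
          ext <;> simp
        rw [this]
        exact Submodule.smul_mem _ _ hx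
  -- M is built as a quotient of the projective cover P of the upper part (1 - e)X. J kills this
  -- part, so π has kernel exactly rad P.
  obtain ⟨P, π₀, hπ⟩ := exists_projectiveCover Λ (LinearMap.range U)
  have := hπ.projective
  have := hπ.finite
  let π : P →ₗ[Λ] X := (LinearMap.range U).subtype ∘ₗ π₀
  have hker : ∀ y, π y = 0 → y ∈ rad Λ P := fun y hy => hπ.ker_le_rad (Subtype.ext hy)
  have hker' : ∀ y ∈ rad Λ P, π y = 0 := by
    have : rad Λ P ≤ LinearMap.ker π := rad_le_of_smul_mem fun a ha p => by
      rw [LinearMap.mem_ker, map_smul, hsc]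
      exact Sep.diag_smul_eq_zero hrad ha ha _
    exact this
  have hUπ : ∀ p, Sep.mk (1 : Λ) 0 0 • π p = π p := fun p => by
    obtain ⟨x, hx⟩ := (π₀ p).2
    change Sep.mk (1 : Λ) 0 0 • (π₀ p : X) = π₀ p
    rw [← hx, hU, smul_smul]
    congr 1
    ext <;> simp
  have hsπ : ∀ (s : Sep Λ) p, s • π p = s.a • π p + Sep.mk 0 0 s.x • π p := fun s p => by
    conv_lhs => rw [← hUπ p, smul_smul]
    conv_rhs => rw [← hUπ p, hsc, smul_smul, smul_smul, ← add_smul]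
    congr 1
    ext <;> simp
  obtain ⟨n, b, q, hb⟩ := exists_dualBasis (Λ := Λ) P
  have hq : ∀ i, ∀ y ∈ rad Λ P, q i y ∈ Ring.jacobson Λ := fun i y hy => by
    have : rad Λ P ≤ Submodule.comap (q i) (Ring.jacobson Λ) := rad_le_of_smul_mem fun a ha p => by
      rw [Submodule.mem_comap, map_smul, smul_eq_mul]
      exact Ideal.mul_mem_right _ _ ha
    exact this hy
  -- The action of J on the upper part should send xp to xπ(p). The dual basis gives a formula in y
  -- = xp alone, which makes this well defined; its kernel is what has to be divided out of P.
  let ρ : rad Λ P →ₗ[Λ] X :=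
    { toFun := fun y => ∑ i, Sep.mk 0 0 ⟨q i y, hq i y y.2⟩ • π (b i)
      map_add' := fun y z => by
        rw [← Finset.sum_add_distrib]
        refine Finset.sum_congr rfl fun i _ => ?_
        rw [← add_smul]
        congr 1
        ext <;> simp
      map_smul' := fun c y => by
        rw [RingHom.id_apply, Finset.smul_sum]
        refine Finset.sum_congr rfl fun i _ => ?_
        rw [hsc, smul_smul]
        congr 1
        ext <;> simp }
  have hρ : ∀ (x : Ring.jacobson Λ) p, ρ ⟨(x : Λ) • p, smul_mem_rad x.2 p⟩ =
      Sep.mk 0 0 x • π p := fun x p => by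
    conv_rhs => rw [← hb p, map_sum, Finset.smul_sum]
    change ∑ i, Sep.mk 0 0 ⟨q i ((x : Λ) • p), _⟩ • π (b i) = _
    refine Finset.sum_congr rfl fun i _ => ?_
    rw [map_smul π, hsc, smul_smul]
    congr 1
    ext <;> simp
  have heρ : ∀ y, Sep.e Λ • ρ y = ρ y := fun y => by
    change Sep.e Λ • ∑ i, Sep.mk 0 0 ⟨q i y, hq i y y.2⟩ • π (b i) = _
    rw [Finset.smul_sum]
    refine Finset.sum_congr rfl fun i _ => ?_
    rw [smul_smul]
    congr 1
    ext <;> simp [Sep.e]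
  have hsρ : ∀ (s : Sep Λ) y, s • ρ y = s.b • ρ y := fun s y => by
    rw [← heρ y, hsc, smul_smul, smul_smul]
    congr 1
    ext <;> simp [Sep.e]
  let K : Submodule Λ P := (LinearMap.ker ρ).map (rad Λ P).subtype
  have hK : K ≤ rad Λ P := Submodule.map_subtype_le _ _
  have hKρ : ∀ y : rad Λ P, (y : P) ∈ K → ρ y = 0 := by
    rintro y ⟨z, hz, hzy⟩
    rw [← show z = y from Subtype.ext hzy]
    exact hz
  let M := P ⧸ K
  let t : rad Λ P →ₗ[Λ] rad Λ M :=
    (K.mkQ ∘ₗ (rad Λ P).subtype).codRestrict _ fun y => map_mem_rad K.mkQ y.2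
  have ht : Function.Surjective t := by
    have : rad Λ M ≤ (rad Λ P).map K.mkQ := rad_le_of_smul_mem fun a ha m => by
      obtain ⟨p, rfl⟩ := K.mkQ_surjective m
      exact ⟨a • p, smul_mem_rad ha p, map_smul _ _ _⟩
    intro w
    obtain ⟨y, hy, hyw⟩ := this w.2
    exact ⟨⟨y, hy⟩, Subtype.ext hyw⟩
  have ht0 : ∀ y, t y = 0 ↔ (y : P) ∈ K := fun y =>
    Subtype.ext_iff.trans (Submodule.Quotient.mk_eq_zero K)
  obtain ⟨σ, hσ⟩ := exists_factor ht ρ fun y hy => hKρ y ((ht0 y).1 hy)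
  have hσ0 : ∀ w, σ w = 0 → w = 0 := fun w hw => by
    obtain ⟨y, rfl⟩ := ht w
    rw [hσ] at hw
    exact (ht0 y).2 ⟨y, hw, rfl⟩
  have hQ : Function.Surjective ((rad Λ M).mkQ ∘ₗ K.mkQ) :=
    (rad Λ M).mkQ_surjective.comp K.mkQ_surjective
  obtain ⟨θ, hθ⟩ := exists_factor hQ π fun p hp => by
    have h1 : K.mkQ p ∈ rad Λ M := (Submodule.Quotient.mk_eq_zero _).1 hp
    obtain ⟨y, hy⟩ := ht ⟨_, h1⟩
    have h2 : p - y ∈ K := (Submodule.Quotient.eq K).1 (congrArg Subtype.val hy).symm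
    exact hker' p (by simpa using add_mem (hK h2) y.2)
  have hθ' : ∀ p : P, θ (Submodule.Quotient.mk (Submodule.Quotient.mk p : M)) = π p := hθ
  have hθ0 : ∀ z, θ z = 0 → z = 0 := fun z hz => by
    obtain ⟨m, rfl⟩ := Submodule.Quotient.mk_surjective _ z
    obtain ⟨p, rfl⟩ := Submodule.Quotient.mk_surjective _ m
    rw [hθ'] at hz
    exact (Submodule.Quotient.mk_eq_zero _).2 (map_mem_rad K.mkQ (hker p hz))
  let Φ : Separated hrad M →ₗ[Sep Λ] X :=
    { toFun := fun z => θ z.1 + σ z.2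
      map_add' := fun z z' => by
        change θ (z.1 + z'.1) + σ (z.2 + z'.2) = _
        rw [map_add, map_add]
        abel
      map_smul' := fun s z => by
        obtain ⟨v, w⟩ := z
        obtain ⟨m, rfl⟩ := Submodule.Quotient.mk_surjective _ v
        obtain ⟨p, rfl⟩ := Submodule.Quotient.mk_surjective _ m
        obtain ⟨y, rfl⟩ := ht w
        change θ (s.a • _) + σ (s.b • t y + act hrad s.x _) = s • (θ _ + σ (t y))
        have h1 : act hrad s.x (Submodule.Quotient.mk (Submodule.Quotient.mk p : M)) =
            t ⟨(s.x : Λ) • p, smul_mem_rad s.x.2 p⟩ := rfl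
        rw [h1, map_smul, map_add, map_smul, hσ, hσ, hθ', hρ, smul_add, hsπ s p, hsρ]
        abel }
  have hΦ : ∀ z, Φ z = θ z.1 + σ z.2 := fun _ => rfl
  have heσ : ∀ w, Sep.e Λ • σ w = σ w := fun w => by
    obtain ⟨y, rfl⟩ := ht w
    rw [hσ, heρ]
  have heθ : ∀ z, Sep.e Λ • θ z = 0 := fun z => by
    obtain ⟨m, rfl⟩ := Submodule.Quotient.mk_surjective _ z
    obtain ⟨p, rfl⟩ := Submodule.Quotient.mk_surjective _ m
    rw [hθ', ← hUπ, smul_smul]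
    convert zero_smul (Sep Λ) _ using 2
    ext <;> simp [Sep.e]
  have hinj : Function.Injective Φ := by
    refine (injective_iff_map_eq_zero Φ).2 fun z hz => ?_
    rw [hΦ] at hz
    have h1 := congrArg (Sep.e Λ • ·) hz
    simp only [smul_add, heσ, heθ, zero_add, smul_zero] at h1
    rw [h1, add_zero] at hz
    exact Prod.ext (hθ0 _ hz) (hσ0 _ h1)
  have hmem : ∀ x : X, (1 - Sep.e Λ) • x ∈ LinearMap.range Φ := fun x => by
    obtain ⟨p, hp⟩ := hπ.surjective ⟨U x, x, rfl⟩
    have hp' : π p = U x := congrArg Subtype.val hp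
    refine ⟨Separated.mk hrad (Submodule.Quotient.mk (Submodule.Quotient.mk p : M)) 0, ?_⟩
    rw [he, ← hU, ← hp', hΦ]
    refine Eq.trans ?_ (add_zero (π p))
    exact congrArg₂ (· + ·) (hθ' p) (map_zero σ)
  -- The image of the embedding Φ contains (1 - e)X, which is nonzero, so indecomposability of X
  -- makes it everything.
  have hsurj : LinearMap.range Φ = ⊤ :=
    hX.eq_top_of_one_sub_smul_mem Sep.isTriangular hmem fun h => hx₀ (by
      have h1 := hmem x₀
      rwa [h, Submodule.mem_bot] at h1)
  exact ⟨ModuleCat.of Λ M, inferInstanceAs (Module.Finite Λ (P ⧸ K)),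
    ⟨LinearEquiv.ofBijective Φ ⟨hinj, LinearMap.range_eq_top.1 hsurj⟩⟩⟩

/-- If `Λ` has finite representation type, then separated modules of indecomposable modules have no
self-extensions. -/
theorem IsFiniteType.extZero (hfin : IsFiniteType Λ) {M : Type u} [AddCommGroup M] [Module Λ M]
    [Module.Finite Λ M] (hM : IsIndecomposable Λ M) :
    ExtZero (Sep.diag Λ) (Separated hrad M) (Separated hrad M) := by
  by_contra hext
  have hflen := Separated.finite_length hrad (M := M)
  have := hflen.1
  have := hflen.2
  have := Separated.isSemisimpleModule hrad (M := M)
  obtain ⟨B, hB, hBext⟩ := exists_brick Sep.isTriangular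
    (Separated.isIndecomposable hrad hM) hext
  have hBss : IsSemisimpleModule (Sep.diag Λ) B := isSemisimpleModule_submodule B
  -- Derivations factor through the upper part (1 - e)B. Were it zero, all of them would vanish and
  -- B would have no self-extensions.
  obtain ⟨b, hb⟩ : ∃ b : B, (1 - Sep.e Λ) • b ≠ 0 := by
    by_contra! h
    refine hBext fun δ hδ => ⟨0, fun r x => ?_⟩
    rw [← hδ.apply_one_sub_smul Sep.isTriangular, h, map_zero]
    simp
  obtain ⟨N, Y, hY⟩ := hfin
  -- Each length (n + 1)·ℓ(B) is attained by the separated module of one of the finitely many Y i.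
  -- As ℓ(B) is finite and nonzero, the pigeonhole principle gives a contradiction.
  have key : ∀ n : ℕ, ∃ i, Module.length (Sep Λ) (Separated hrad (Y i)) =
      (n + 1) * Module.length (Sep Λ) B := fun n => by
    obtain ⟨X, _, _, _, i, hi, hX, hlen⟩ :=
      exists_indecomposable_length Sep.isTriangular hB hBext n
    obtain ⟨L, hL, ⟨E⟩⟩ := exists_separated_equiv hrad hX (x₀ := i b) (by
      rw [← map_smul]
      exact fun h => hb (hi (h.trans (map_zero i).symm)))
    obtain ⟨j, ⟨F⟩⟩ := hY L hL
      (Separated.isIndecomposable_of_separated hrad (hX.of_equiv E.symm))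
    exact ⟨j, ((Separated.mapEquiv hrad F).symm.trans E).length_eq.trans hlen⟩
  choose f hf using key
  obtain ⟨n, m, hnm, hne⟩ : ∃ n m, f n = f m ∧ n ≠ m := by
    simpa [Function.Injective] using not_injective_infinite_finite f
  have h1 := (hf n).symm.trans ((congrArg (fun i => Module.length (Sep Λ)
    (Separated hrad (Y i))) hnm).trans (hf m))
  have hBnt := hB.1
  have h2 : Module.length (Sep Λ) B ≠ 0 := Module.length_pos.ne'
  obtain ⟨l, hl⟩ := ENat.ne_top_iff_exists.1 (Module.length_ne_top (R := Sep Λ) (M := B))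
  rw [← hl] at h1 h2
  have h3 : (n + 1) * l = (m + 1) * l := by exact_mod_cast h1
  have h4 := Nat.eq_of_mul_eq_mul_right (Nat.pos_of_ne_zero (by exact_mod_cast h2)) h3
  omega

end Density

end TauRigid

theorem theorem3p12 (R : Type w) [CommRing R] [IsArtinianRing R]
    (Λ : Type u) [Ring Λ] [Algebra R Λ] [Module.Finite R Λ]
    (hbasic : TauRigid.IsBasic Λ) (hconn : TauRigid.IsConnected Λ)
    (hnss : ¬ IsSemisimpleRing Λ)
    (hgor : TauRigid.IsGorenstein Λ) (hfin : TauRigid.IsFiniteType Λ)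
    (hrad : TauRigid.IsRadicalSquareZero Λ) :
    (Module.Injective Λ Λ → IsLocalRing Λ →
      ∀ (M : Type u) [AddCommGroup M] [Module Λ M] [Module.Finite Λ M],
        TauRigid.IsIndecomposable Λ M → TauRigid.IsTauRigid R Λ M → Module.Projective Λ M) ∧
    (Module.Injective Λ Λ → ¬ IsLocalRing Λ →
      ∀ (M : Type u) [AddCommGroup M] [Module Λ M] [Module.Finite Λ M],
        TauRigid.IsIndecomposable Λ M → TauRigid.IsTauRigid R Λ M) ∧
    (TauRigid.HasFiniteGlobalDimension Λ →
      ∀ (M : Type u) [AddCommGroup M] [Module Λ M] [Module.Finite Λ M],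
        TauRigid.IsIndecomposable Λ M →
          (TauRigid.IsTauRigid R Λ M ↔
            TauRigid.NoCommonSummand Λ (TauRigid.P₀ R Λ M) (TauRigid.P₁ R Λ M))) := by
  have hart : IsArtinianRing Λ := IsArtinianRing.of_finite R Λ
  refine ⟨fun _ hloc M _ _ _ hM h => ?_, fun hinj hloc M _ _ _ hM => ?_, fun _ M _ _ _ hM =>
    ⟨fun h => ?_, fun h => ?_⟩⟩
  · have := hM.1
    exact TauRigid.projective_of_isTauRigid_of_isLocalRing h
  · exact TauRigid.isTauRigid_of_injective hbasic hconn hrad hinj hloc hM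
  · exact TauRigid.noCommonSummand_of_isTauRigid h
  · exact TauRigid.isTauRigid_of_factors fun f => TauRigid.factors_of_extZero hrad
      (hfin.extZero hrad hM) f (TauRigid.range_le_rad_of_noCommonSummand h f)

end
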